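/- **Setting.** Let $\mathcal S,\mathcal A^1,\mathcal A^2$ be finite non-empty sets, $p(\cdot\mid s,a^1,a^2)$ a controlled transition kernel on $\mathcal S$ and $\underline c:\mathcal S\times\mathcal A^1\times\mathcal A^2\to\mathbb R^K$ a vector cost. In the Stackelberg stochastic game, at each time $n\ge 0$ agent 1 chooses $a^1_n$, agent 2 observes it and chooses $a^2_n$, and then $s_{n+1}\sim p(\cdot\mid s_n,a^1_n,a^2_n)$. A behavioral strategy of agent 1 (resp. agent 2) chooses, at each time $m$, the law of $a^1_m$ (resp. $a^2_m$) as a function of the past states and actions of both agents and of $s_m$ (resp. of $s_m$ and $a^1_m$). Put $x_n=\frac1n\sum_{m=1}^n\underline c(s_m,a^1_m,a^2_m)$. A closed set $D\subset\mathbb R^K$ is *approachable* (from all initial states) if there is a behavioral strategy $\sigma^1$ of agent 1 such that $\mathrm{dist}(x_n,D)\to0$ almost surely for every behavioral strategy $\sigma^2$ of agent 2 and every initial state $s_0$. A stationary pair is $\pi^1:\mathcal S\to\mathcal P(\mathcal A^1)$, $\pi^2:\mathcal S\times\mathcal A^1\to\mathcal P(\mathcal A^2)$. An *ergodic occupation measure*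 of $(\pi^1,\pi^2)$ is a law $\psi(s,a^1,a^2)=\eta(s)\pi^1(a^1|s)\pi^2(a^2|s,a^1)$ with $\eta$ an invariant law of the Markov chain that $(\pi^1,\pi^2)$ induces on $\mathcal S$; write $\underline c(\psi)=\sum_{s,a^1,a^2}\psi(s,a^1,a^2)\,\underline c(s,a^1,a^2)$. Assume that the Markov chain on $\mathcal S$ induced by any stationary pair is irreducible. Let $D\subset\mathbb R^K$ be non-empty, closed and convex. For $x\notin D$ let $P_D(x)$ be the projection of $x$ onto $D$, $\lambda(x)=(x-P_D(x))/\|x-P_D(x)\|$, and $$c^*(x)=\min_{\pi^1}\max_{\pi^2}\langle\underline c(\psi),\lambda(x)\rangle,$$ where $\psi$ is the ergodic occupation measure of $(\pi^1,\pi^2)$. **Proposition.** Suppose that $D$ is approachable. Then (i) every closed half-space $\{y:\langle y,v\rangle\le b\}$, $v\ne0$, containing $D$ is approachable; (ii) for every $x\in\mathbb R^K\setminus D$ there is an ergodic occupation measure $\psi$, of a stationary pair $(\pi^1,\pi^2)$ in which $\pi^1$ attains the minimum and $\pi^2$ attains the maximum against $\pi^1$, such that $\langle\underline c(\psi),\lambda(x)\rangle=c^*(x)$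 and $\langle\underline c(\psi)-P_D(x),\lambda(x)\rangle\le0$. Moreover, $D$ is approachable if and only if for every $x\in\mathbb R^K\setminus D$ there is an ergodic occupation measure $\psi$ with $\langle\underline c(\psi),\lambda(x)\rangle=c^*(x)$ and $\langle\underline c(\psi)-P_D(x),\lambda(x)\rangle\le0$. -/

import Mathlib

open MeasureTheory ProbabilityTheory Filter Topology

/-- One stage of play: the state, the leader's action and the follower's action. -/
structure Stage (S A₁ A₂ : Type*) where
  state : S
  act₁ : A₁
  act₂ : A₂

namespace Stage

variable {S A₁ A₂ : Type*}

instance : MeasurableSpace (Stage S A₁ A₂) := ⊤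

instance : DiscreteMeasurableSpace (Stage S A₁ A₂) := ⟨fun _ => trivial⟩

instance [Finite S] [Finite A₁] [Finite A₂] : Finite (Stage S A₁ A₂) :=
  Finite.of_injective (fun z => (z.state, z.act₁, z.act₂)) (by
    rintro ⟨_, _, _⟩ ⟨_, _, _⟩ h
    simpa using h)

end Stage

/-- A Stackelberg stochastic game with vector costs in `ℝ^K`: a controlled transition kernel
`p(s, (a¹, a²), ·)` and a vector-cost function `c(s, a¹, a²)`. -/
structure StackelbergGame (S A₁ A₂ : Type*) (K : ℕ) where
  trans : S → A₁ → A₂ → PMF S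
  cost : S → A₁ → A₂ → EuclideanSpace ℝ (Fin K)

/-- Behavioral strategies of the leader: at each time `m` the past stages `0, …, m - 1` and the
current state are mapped to a law on `A₁`. -/
abbrev LeaderStrategy (S A₁ A₂ : Type*) : Type _ :=
  (m : ℕ) → (Fin m → Stage S A₁ A₂) → S → PMF A₁

/-- Behavioral strategies of the follower, who moreover observes the leader's current action. -/
abbrev FollowerStrategy (S A₁ A₂ : Type*) : Type _ :=
  (m : ℕ) → (Fin m → Stage S A₁ A₂) → S → A₁ → PMF A₂

/-- The law of a stage in which the state is drawn from `ν`, then the leader's action from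
`ρ₁(· | s)`, and then the follower's action from `ρ₂(· | s, a¹)`. -/
noncomputable def stageLaw {S A₁ A₂ : Type*} (ν : PMF S) (ρ₁ : S → PMF A₁)
    (ρ₂ : S → A₁ → PMF A₂) : PMF (Stage S A₁ A₂) :=
  ν.bind fun s => (ρ₁ s).bind fun a₁ => (ρ₂ s a₁).bind fun a₂ => PMF.pure ⟨s, a₁, a₂⟩

namespace StackelbergGame

variable {S A₁ A₂ : Type*} [Fintype S] [Fintype A₁] [Fintype A₂] {K : ℕ}

/-- The conditional law of stage `n + 1` given the stages `0, …, n`. -/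
noncomputable def nextStage (G : StackelbergGame S A₁ A₂ K) (σ₁ : LeaderStrategy S A₁ A₂)
    (σ₂ : FollowerStrategy S A₁ A₂) (n : ℕ) (h : Fin (n + 1) → Stage S A₁ A₂) :
    PMF (Stage S A₁ A₂) :=
  stageLaw
    (G.trans (h (Fin.last n)).state (h (Fin.last n)).act₁ (h (Fin.last n)).act₂)
    (σ₁ (n + 1) h) (σ₂ (n + 1) h)

/-- `nextStage` as a Markov kernel on histories. -/
noncomputable def stepKernel (G : StackelbergGame S A₁ A₂ K) (σ₁ : LeaderStrategy S A₁ A₂)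
    (σ₂ : FollowerStrategy S A₁ A₂) (n : ℕ) :
    Kernel (Finset.Iic n → Stage S A₁ A₂) (Stage S A₁ A₂) where
  toFun h := (G.nextStage σ₁ σ₂ n fun i =>
    h ⟨i, Finset.mem_Iic.2 (Nat.lt_succ_iff.1 i.2)⟩).toMeasure
  measurable' := measurable_of_countable _

instance (G : StackelbergGame S A₁ A₂ K) (σ₁ : LeaderStrategy S A₁ A₂)
    (σ₂ : FollowerStrategy S A₁ A₂) (n : ℕ) : IsMarkovKernel (G.stepKernel σ₁ σ₂ n) :=
  ⟨fun _ => PMF.toMeasure.isProbabilityMeasure _⟩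

/-- The law of the play `(s_n, a¹_n, a²_n)_{n ≥ 0}` started at `s₀` under the strategies
`σ₁`, `σ₂`. -/
noncomputable def law (G : StackelbergGame S A₁ A₂ K) (σ₁ : LeaderStrategy S A₁ A₂)
    (σ₂ : FollowerStrategy S A₁ A₂) (s₀ : S) : Measure (ℕ → Stage S A₁ A₂) :=
  Kernel.trajMeasure (X := fun _ => Stage S A₁ A₂)
    (stageLaw (PMF.pure s₀) (σ₁ 0 Fin.elim0) (σ₂ 0 Fin.elim0)).toMeasure
    (G.stepKernel σ₁ σ₂)

/-- The average vector-cost `x_n = (1/n) ∑_{m=1}^n c(s_m, a_m)` of a play. -/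
noncomputable def avgCost (G : StackelbergGame S A₁ A₂ K) (ω : ℕ → Stage S A₁ A₂) (n : ℕ) :
    EuclideanSpace ℝ (Fin K) :=
  (n : ℝ)⁻¹ • ∑ m ∈ Finset.Icc 1 n, G.cost (ω m).state (ω m).act₁ (ω m).act₂

/-- `D` is approachable (from all initial states) for the leader: some behavioral strategy of the
leader makes `dist(x_n, D) → 0` almost surely against every behavioral strategy of the follower
and from every initial state. -/
def Approachable (G : StackelbergGame S A₁ A₂ K) (D : Set (EuclideanSpace ℝ (Fin K))) : Prop :=
  ∃ σ₁ : LeaderStrategy S A₁ A₂, ∀ (σ₂ : FollowerStrategy S A₁ A₂) (s₀ : S),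
    ∀ᵐ ω ∂(G.law σ₁ σ₂ s₀), Tendsto (fun n => Metric.infDist (G.avgCost ω n) D) atTop (𝓝 0)

/-- The law of the next state when the current stage has law `ψ`. -/
noncomputable def nextState (G : StackelbergGame S A₁ A₂ K) (ψ : PMF (Stage S A₁ A₂)) : PMF S :=
  ψ.bind fun z => G.trans z.state z.act₁ z.act₂

/-- The transition matrix of the state process under a pair of stationary strategies. -/
noncomputable def chainMatrix (G : StackelbergGame S A₁ A₂ K) (π₁ : S → PMF A₁)
    (π₂ : S → A₁ → PMF A₂) : Matrix S S ℝ :=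
  Matrix.of fun s t => (G.nextState (stageLaw (PMF.pure s) π₁ π₂) t).toReal

/-- Every pair of stationary strategies induces an irreducible Markov chain on the states. -/
def Irreducible (G : StackelbergGame S A₁ A₂ K) : Prop :=
  ∀ (π₁ : S → PMF A₁) (π₂ : S → A₁ → PMF A₂), (G.chainMatrix π₁ π₂).IsIrreducible

/-- `ψ(s, a¹, a²) = η(s) π₁(a¹|s) π₂(a²|s, a¹)` with `η` an invariant law of the chain induced by
the stationary pair `(π₁, π₂)`. -/
def IsOccupation (G : StackelbergGame S A₁ A₂ K) (π₁ : S → PMF A₁) (π₂ : S → A₁ → PMF A₂)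
    (ψ : PMF (Stage S A₁ A₂)) : Prop :=
  ∃ η : PMF S, G.nextState (stageLaw η π₁ π₂) = η ∧ ψ = stageLaw η π₁ π₂

/-- The set `Ψ` of ergodic occupation measures. -/
def ergodicOccupations (G : StackelbergGame S A₁ A₂ K) : Set (PMF (Stage S A₁ A₂)) :=
  {ψ | ∃ (π₁ : S → PMF A₁) (π₂ : S → A₁ → PMF A₂), G.IsOccupation π₁ π₂ ψ}

/-- The ergodic vector-cost `c(ψ)`. -/
noncomputable def ergodicCost (G : StackelbergGame S A₁ A₂ K) (ψ : PMF (Stage S A₁ A₂)) :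
    EuclideanSpace ℝ (Fin K) :=
  ∑ s, ∑ a₁, ∑ a₂, (ψ ⟨s, a₁, a₂⟩).toReal • G.cost s a₁ a₂

/-- `max_{π₂} ⟨c(ψ), u⟩` for a fixed stationary strategy `π₁` of the leader. -/
noncomputable def worstCost (G : StackelbergGame S A₁ A₂ K) (u : EuclideanSpace ℝ (Fin K))
    (π₁ : S → PMF A₁) : ℝ :=
  sSup {r | ∃ (π₂ : S → A₁ → PMF A₂) (ψ : PMF (Stage S A₁ A₂)),
    G.IsOccupation π₁ π₂ ψ ∧ r = inner ℝ (G.ergodicCost ψ) u}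

/-- The min-max value `min_{π₁} max_{π₂} ⟨c(ψ), u⟩`. -/
noncomputable def minMaxValue (G : StackelbergGame S A₁ A₂ K) (u : EuclideanSpace ℝ (Fin K)) :
    ℝ :=
  ⨅ π₁ : S → PMF A₁, G.worstCost u π₁

/-- The ergodic occupation measures of the stationary pairs `(π₁, π₂)` in which `π₁` attains the
minimum over the leader's stationary strategies and `π₂` attains the maximum against `π₁`. -/
def minMaxOccupations (G : StackelbergGame S A₁ A₂ K) (u : EuclideanSpace ℝ (Fin K)) :
    Set (PMF (Stage S A₁ A₂)) :=
  {ψ | ∃ (π₁ : S → PMF A₁) (π₂ : S → A₁ → PMF A₂), G.IsOccupation π₁ π₂ ψ ∧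
    (∀ π₁', G.worstCost u π₁ ≤ G.worstCost u π₁') ∧
    (∀ π₂' ψ', G.IsOccupation π₁ π₂' ψ' →
      inner ℝ (G.ergodicCost ψ') u ≤ inner ℝ (G.ergodicCost ψ) u)}

end StackelbergGame

/-- The projection `P_D(x)`: a point of `D` at minimal distance from `x`. It exists for `D` closed
and non-empty, and is unique for `D` convex. -/
noncomputable def projPoint {K : ℕ} (D : Set (EuclideanSpace ℝ (Fin K)))
    (x : EuclideanSpace ℝ (Fin K)) : EuclideanSpace ℝ (Fin K) :=
  Classical.epsilon fun y => y ∈ D ∧ Metric.infDist x D = dist x y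

theorem projPoint_spec {K : ℕ} {D : Set (EuclideanSpace ℝ (Fin K))} (hc : IsClosed D)
    (hne : D.Nonempty) (x : EuclideanSpace ℝ (Fin K)) :
    projPoint D x ∈ D ∧ Metric.infDist x D = dist x (projPoint D x) := by
  obtain ⟨y, hy, h⟩ := hc.exists_infDist_eq_dist hne x
  exact Classical.epsilon_spec (p := fun y => y ∈ D ∧ Metric.infDist x D = dist x y) ⟨y, hy, h⟩

/-- The unit vector `λ(x) = (x - P_D(x)) / ‖x - P_D(x)‖`, for `x ∉ D`. -/
noncomputable def steerDir {K : ℕ} (D : Set (EuclideanSpace ℝ (Fin K)))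
    (x : EuclideanSpace ℝ (Fin K)) : EuclideanSpace ℝ (Fin K) :=
  ‖x - projPoint D x‖⁻¹ • (x - projPoint D x)

/-! Fix a direction `u` with `‖u‖ ≤ 1` and score costs by `⟨c, u⟩`. Since the follower sees the
leader's action, the min-max at each state is attained by pure actions, and the scalar game is
governed by the optimality equation `v + h(s) = min_{a₁} max_{a₂} (⟨c, u⟩ + E h)`. It is solved by
letting the discount factor tend to one (`exists_isOptimal`); irreducibility bounds the oscillation
of `h` uniformly in the discount and in `u`. Averaging the equation against invariant laws
identifies `v` with the stationary min-max value, attained by pure selectors.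

Necessity (`IsOptimal.le_of_approachable`): the follower's selector forces an expected average score
of at least `v - H/n`, whatever the leader does. If the averages approach `D`, then `v` is at most
any upper bound of `⟨·, u⟩` on `D`; for convex `D` and `u = λ(x)` such a bound is `⟨P_D(x), u⟩`.

Sufficiency (`approachable_of_minMaxValue_le`) is Blackwell's argument in blocks. From time `k²` to
`(k+1)²` the leader plays the optimal selector for the direction from the projection to the current
average. The relative value function makes the expected inner product over a block bounded, however
long the block is. Expanding the square of time times distance then gives mean square distance
`O(1/k)` at time `k²`. This is summable along `k = j²`, so the distance vanishes almost surely at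
times `j⁴`, and the averages move little between consecutive such times. -/

namespace PMF

/-! ### Expectations and invariant laws on finite sets -/

variable {α β : Type*} [Fintype α]

/-- The expectation of a real function under a law on a finite type. -/
noncomputable def expect (p : PMF α) (f : α → ℝ) : ℝ := ∑ a, (p a).toReal * f a

theorem sum_toReal (p : PMF α) : ∑ a, (p a).toReal = 1 := by
  rw [← ENNReal.toReal_sum fun a _ => p.apply_ne_top a, ← tsum_fintype (L := .unconditional _),
    p.tsum_coe, ENNReal.toReal_one]

theorem expect_mono (p : PMF α) {f g : α → ℝ} (h : ∀ a, f a ≤ g a) : p.expect f ≤ p.expect g :=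
  Finset.sum_le_sum fun a _ => mul_le_mul_of_nonneg_left (h a) ENNReal.toReal_nonneg

theorem expect_const (p : PMF α) (c : ℝ) : p.expect (fun _ => c) = c := by
  simp [expect, ← Finset.sum_mul, p.sum_toReal]

theorem expect_add (p : PMF α) (f g : α → ℝ) :
    p.expect (fun a => f a + g a) = p.expect f + p.expect g := by
  simp [expect, mul_add, Finset.sum_add_distrib]

theorem expect_sub (p : PMF α) (f g : α → ℝ) :
    p.expect (fun a => f a - g a) = p.expect f - p.expect g := by
  simp [expect, mul_sub, Finset.sum_sub_distrib]

theorem expect_const_mul (p : PMF α) (c : ℝ) (f : α → ℝ) :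
    p.expect (fun a => c * f a) = c * p.expect f := by
  simp only [expect, Finset.mul_sum]
  exact Finset.sum_congr rfl fun a _ => by ring

theorem expect_pure (a : α) (f : α → ℝ) : (PMF.pure a).expect f = f a := by
  classical
  rw [expect, Finset.sum_eq_single a]
  · simp
  · intro b _ hb
    simp [PMF.pure_apply, hb]
  · simp

theorem toReal_bind_apply (p : PMF α) (q : α → PMF β) (b : β) :
    (p.bind q b).toReal = ∑ a, (p a).toReal * (q a b).toReal := by
  rw [PMF.bind_apply, tsum_fintype, ENNReal.toReal_sum]
  · simp
  · exact fun a _ => ENNReal.mul_ne_top (p.apply_ne_top a) ((q a).apply_ne_top b)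

theorem expect_bind [Fintype β] (p : PMF α) (q : α → PMF β) (f : β → ℝ) :
    (p.bind q).expect f = p.expect fun a => (q a).expect f := by
  simp only [expect, toReal_bind_apply, Finset.sum_mul, Finset.mul_sum]
  rw [Finset.sum_comm]
  simp only [mul_assoc]

theorem expect_le_const (p : PMF α) {f : α → ℝ} {c : ℝ} (h : ∀ a, f a ≤ c) : p.expect f ≤ c :=
  (p.expect_mono h).trans_eq (p.expect_const c)

theorem const_le_expect (p : PMF α) {f : α → ℝ} {c : ℝ} (h : ∀ a, c ≤ f a) : c ≤ p.expect f :=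
  (p.expect_const c).symm.trans_le (p.expect_mono h)

/-- A Markov chain on a finite non-empty state space has an invariant law. -/
theorem exists_bind_eq_self [Nonempty α] (k : α → PMF α) : ∃ η : PMF α, η.bind k = η := by
  classical
  set P : Matrix α α ℝ := Matrix.of fun s t => (k s t).toReal with hP
  have hrow : ∀ s, ∑ t, P s t = 1 := fun s => (k s).sum_toReal
  have hP0 : ∀ s t, 0 ≤ P s t := fun s t => ENNReal.toReal_nonneg
  -- Unit row sums put the constant vector in the right kernel of `P - 1`, so a left null vector
  -- exists too.
  have hdet : (P - 1).det = 0 := by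
    refine Matrix.exists_mulVec_eq_zero_iff.1 ⟨1, one_ne_zero, ?_⟩
    ext s
    simp [Matrix.mulVec, dotProduct, hrow, Matrix.one_apply]
  obtain ⟨v, hv0, hv⟩ := Matrix.exists_vecMul_eq_zero_iff.2 hdet
  have hvP : ∀ t, ∑ s, v s * P s t = v t := by
    intro t
    have := congrFun hv t
    simpa [Matrix.vecMul, dotProduct, mul_sub, Matrix.one_apply, sub_eq_zero] using this
  have hle : ∀ t ∈ Finset.univ, |v t| ≤ ∑ s, |v s| * P s t := by
    intro t _
    rw [← hvP t]
    refine (Finset.abs_sum_le_sum_abs _ _).trans_eq (Finset.sum_congr rfl fun s _ => ?_)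
    rw [abs_mul, abs_of_nonneg (hP0 s t)]
  have hsum : ∑ t, |v t| = ∑ t, ∑ s, |v s| * P s t := by
    rw [Finset.sum_comm]
    simp [← Finset.mul_sum, hrow]
  -- `|v| ≤ |v| P` entrywise with equal total masses forces equality, so `|v|` is invariant and only
  -- needs normalizing.
  have heq := (Finset.sum_eq_sum_iff_of_le hle).1 hsum
  have hpos : 0 < ∑ t, |v t| := by
    obtain ⟨t, ht⟩ := Function.ne_iff.1 hv0
    exact Finset.sum_pos' (fun _ _ => abs_nonneg _) ⟨t, Finset.mem_univ _, abs_pos.2 ht⟩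
  set N := ∑ t, |v t|
  have hnn : ∀ s, 0 ≤ |v s| / N := fun s => div_nonneg (abs_nonneg _) hpos.le
  refine ⟨PMF.ofFintype (fun s => ENNReal.ofReal (|v s| / N)) ?_, ?_⟩
  · rw [← ENNReal.ofReal_sum_of_nonneg fun s _ => hnn s, ← Finset.sum_div, div_self hpos.ne',
      ENNReal.ofReal_one]
  · ext t
    rw [← ENNReal.toReal_eq_toReal_iff' (PMF.apply_ne_top _ _) (PMF.apply_ne_top _ _),
      toReal_bind_apply]
    simp only [PMF.ofFintype_apply, ENNReal.toReal_ofReal (hnn _)]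
    rw [heq t (Finset.mem_univ t), Finset.sum_div]
    exact Finset.sum_congr rfl fun s _ => by rw [hP, Matrix.of_apply]; ring

end PMF

namespace Stage

variable {S A₁ A₂ : Type*}

/-- A stage as a triple. -/
def equivProd : Stage S A₁ A₂ ≃ S × A₁ × A₂ where
  toFun z := (z.state, z.act₁, z.act₂)
  invFun p := ⟨p.1, p.2.1, p.2.2⟩

instance [Fintype S] [Fintype A₁] [Fintype A₂] : Fintype (Stage S A₁ A₂) :=
  Fintype.ofEquiv _ equivProd.symm

instance [Nonempty S] [Nonempty A₁] [Nonempty A₂] : Nonempty (Stage S A₁ A₂) :=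
  equivProd.nonempty

theorem sum_eq [Fintype S] [Fintype A₁] [Fintype A₂] {M : Type*} [AddCommMonoid M]
    (f : Stage S A₁ A₂ → M) : ∑ z, f z = ∑ s, ∑ a₁, ∑ a₂, f ⟨s, a₁, a₂⟩ := by
  rw [← equivProd.symm.sum_comp, Fintype.sum_prod_type]
  simp only [Fintype.sum_prod_type]
  rfl

end Stage

theorem expect_stageLaw {S A₁ A₂ : Type*} [Fintype S] [Fintype A₁] [Fintype A₂] (ν : PMF S)
    (ρ₁ : S → PMF A₁) (ρ₂ : S → A₁ → PMF A₂) (f : Stage S A₁ A₂ → ℝ) :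
    (stageLaw ν ρ₁ ρ₂).expect f =
      ν.expect fun s => (ρ₁ s).expect fun a₁ => (ρ₂ s a₁).expect fun a₂ => f ⟨s, a₁, a₂⟩ := by
  simp only [stageLaw, PMF.expect_bind, PMF.expect_pure]

/-! ### The average-cost optimality equation by vanishing discount -/

namespace StackelbergGame

variable {S A₁ A₂ : Type*} {K : ℕ}

theorem chainMatrix_pure (G : StackelbergGame S A₁ A₂ K) (f₁ : S → A₁) (f₂ : S → A₁ → A₂)
    (s t : S) :
    G.chainMatrix (fun s => PMF.pure (f₁ s)) (fun s a => PMF.pure (f₂ s a)) s t =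
      (G.trans s (f₁ s) (f₂ s (f₁ s)) t).toReal := by
  simp [chainMatrix, nextState, stageLaw]

variable [Fintype S] [Fintype A₁] [Fintype A₂]

/-- Iterating the inequality `-R + β P W ≤ W` for a stochastic matrix `P`. -/
theorem iterate_lower_bound {S : Type*} [Fintype S] [DecidableEq S] {P : Matrix S S ℝ}
    (hP0 : ∀ s t, 0 ≤ P s t)
    (hP1 : ∀ s, ∑ t, P s t = 1) {β R : ℝ} (hβ0 : 0 ≤ β) (hβ1 : β ≤ 1) (hR : 0 ≤ R) {W : S → ℝ}
    (hW : ∀ s, -R + β * ∑ t, P s t * W t ≤ W s) (k : ℕ) (s : S) :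
    -(k * R) + β ^ k * ∑ t, (P ^ k) s t * W t ≤ W s := by
  induction k generalizing s with
  | zero => simp [Matrix.one_apply]
  | succ k ih =>
    refine le_trans ?_ (hW s)
    have h1 : ∑ t, P s t * (-(k * R) + β ^ k * ∑ t', (P ^ k) t t' * W t') ≤ ∑ t, P s t * W t :=
      Finset.sum_le_sum fun t _ => mul_le_mul_of_nonneg_left (ih t) (hP0 s t)
    have h2 : ∑ t, P s t * (-(k * R) + β ^ k * ∑ t', (P ^ k) t t' * W t') =
        -(k * R) + β ^ k * ∑ t', (P ^ (k + 1)) s t' * W t' := by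
      simp only [mul_add, Finset.sum_add_distrib, ← Finset.sum_mul, hP1, one_mul]
      congr 1
      simp only [pow_succ' P, Matrix.mul_apply, Finset.sum_mul, Finset.mul_sum]
      rw [Finset.sum_comm]
      exact Finset.sum_congr rfl fun _ _ => Finset.sum_congr rfl fun _ _ => by ring
    rw [h2] at h1
    have h3 := mul_le_mul_of_nonneg_left h1 hβ0
    have h4 : β * (k * R) ≤ k * R := mul_le_of_le_one_left (by positivity) hβ1
    push_cast
    rw [pow_succ']
    nlinarith

/-- Under irreducibility, functions that are almost superharmonic for some pure stationary pair
have uniformly bounded oscillation. -/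
theorem exists_oscillation_bound (G : StackelbergGame S A₁ A₂ K) (hG : G.Irreducible) :
    ∃ C : ℝ, 0 ≤ C ∧ ∀ (f₁ : S → A₁) (f₂ : S → A₁ → A₂) (β R : ℝ) (W : S → ℝ), 1 / 2 ≤ β →
      β ≤ 1 → 0 ≤ R → (∀ s, 0 ≤ W s) → (∃ s, W s = 0) →
      (∀ s, -R + β * (G.trans s (f₁ s) (f₂ s (f₁ s))).expect W ≤ W s) → ∀ s, W s ≤ C * R := by
  classical
  -- There are finitely many pure pairs and pairs of states, so one constant for each suffices; they
  -- are summed at the end.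
  have key : ∀ x : (S → A₁) × (S → A₁ → A₂) × S × S, ∃ C : ℝ, 0 ≤ C ∧
      ∀ (β R : ℝ) (W : S → ℝ), 1 / 2 ≤ β → β ≤ 1 → 0 ≤ R → (∀ s, 0 ≤ W s) → W x.2.2.1 = 0 →
      (∀ s, -R + β * (G.trans s (x.1 s) (x.2.1 s (x.1 s))).expect W ≤ W s) →
        W x.2.2.2 ≤ C * R := by
    rintro ⟨f₁, f₂, i, j⟩
    set P := G.chainMatrix (fun s => PMF.pure (f₁ s)) (fun s a => PMF.pure (f₂ s a)) with hP
    have hirr : P.IsIrreducible := hG _ _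
    obtain ⟨k, -, hk⟩ := (Matrix.isIrreducible_iff_exists_pow_pos hirr.nonneg).1 hirr i j
    -- Iterating `k` times from the zero `i` of `W` gives `β ^ k * (P ^ k) i j * W j ≤ k * R`; the
    -- factor `2 ^ k` absorbs `β ^ k` since `β ≥ 1/2`.
    refine ⟨k * 2 ^ k / (P ^ k) i j, by positivity, fun β R W hβ hβ1 hR hW0 hWi hW => ?_⟩
    have hPt : ∀ s t, P s t = (G.trans s (f₁ s) (f₂ s (f₁ s)) t).toReal := G.chainMatrix_pure f₁ f₂
    have h := iterate_lower_bound (P := P) hirr.nonneg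
      (fun s => by simp only [hPt]; exact PMF.sum_toReal _) (by linarith) hβ1 hR (W := W)
      (fun s => by simpa only [hPt, PMF.expect] using hW s) k i
    simp only at hWi
    rw [hWi] at h
    have h1 : (P ^ k) i j * W j ≤ ∑ t, (P ^ k) i t * W t :=
      Finset.single_le_sum (f := fun t => (P ^ k) i t * W t)
        (fun t _ => mul_nonneg (Matrix.pow_apply_nonneg hirr.nonneg k i t) (hW0 t))
        (Finset.mem_univ j)
    have h2 : (1 / 2 : ℝ) ^ k ≤ β ^ k := pow_le_pow_left₀ (by norm_num) hβ k
    have h3 : (1 / 2 : ℝ) ^ k * ((P ^ k) i j * W j) ≤ k * R := by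
      have := mul_le_mul h2 h1 (mul_nonneg hk.le (hW0 j)) (by positivity)
      linarith
    rw [one_div, inv_pow, inv_mul_le_iff₀ (by positivity)] at h3
    change W j ≤ _
    rw [div_mul_eq_mul_div, le_div_iff₀ hk]
    nlinarith
  choose C hC0 hC using key
  refine ⟨∑ x, C x, Finset.sum_nonneg fun x _ => hC0 x,
    fun f₁ f₂ β R W hβ hβ1 hR hW0 ⟨i, hi⟩ hW j => ?_⟩
  refine (hC (f₁, f₂, i, j) β R W hβ hβ1 hR hW0 hi hW).trans ?_
  exact mul_le_mul_of_nonneg_right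
    (Finset.single_le_sum (f := C) (fun x _ => hC0 x) (Finset.mem_univ _)) hR

/-- The stage cost in direction `u` plus the expected continuation `h`. -/
noncomputable def stageValue (G : StackelbergGame S A₁ A₂ K) (u : EuclideanSpace ℝ (Fin K))
    (h : S → ℝ) (s : S) (a₁ : A₁) (a₂ : A₂) : ℝ :=
  inner ℝ (G.cost s a₁ a₂) u + (G.trans s a₁ a₂).expect h

/-- `(v, h)` solves the average-cost optimality equation in direction `u`, with the pure
stationary selectors `f₁` and `f₂` for the leader and the follower. -/
structure IsOptimal (G : StackelbergGame S A₁ A₂ K) (u : EuclideanSpace ℝ (Fin K)) (v : ℝ)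
    (h : S → ℝ) (f₁ : S → A₁) (f₂ : S → A₁ → A₂) : Prop where
  le : ∀ s a₂, G.stageValue u h s (f₁ s) a₂ ≤ v + h s
  ge : ∀ s a₁, v + h s ≤ G.stageValue u h s a₁ (f₂ s a₁)

/-- A uniform bound on the stage costs. -/
theorem exists_cost_bound (G : StackelbergGame S A₁ A₂ K) :
    ∃ B : ℝ, 0 ≤ B ∧ ∀ s a₁ a₂, ‖G.cost s a₁ a₂‖ ≤ B := by
  obtain ⟨B, hB⟩ := (Set.finite_range fun x : S × A₁ × A₂ =>
    ‖G.cost x.1 x.2.1 x.2.2‖).bddAbove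
  exact ⟨max B 0, le_max_right _ _, fun s a₁ a₂ => le_max_of_le_left (hB ⟨(s, a₁, a₂), rfl⟩)⟩

variable [Nonempty A₁] [Nonempty A₂]

/-- The min-max Bellman operator. -/
noncomputable def bellman (G : StackelbergGame S A₁ A₂ K) (u : EuclideanSpace ℝ (Fin K))
    (h : S → ℝ) (s : S) : ℝ :=
  Finset.univ.inf' Finset.univ_nonempty fun a₁ =>
    Finset.univ.sup' Finset.univ_nonempty fun a₂ => G.stageValue u h s a₁ a₂

/-- Extrema over finite action sets are attained, and the follower may answer each leader action
separately. The Bellman operator is used later only through these two inequalities. -/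
theorem exists_selectors (G : StackelbergGame S A₁ A₂ K) (u : EuclideanSpace ℝ (Fin K))
    (h : S → ℝ) : ∃ (f₁ : S → A₁) (f₂ : S → A₁ → A₂),
      (∀ s a₂, G.stageValue u h s (f₁ s) a₂ ≤ G.bellman u h s) ∧
      (∀ s a₁, G.bellman u h s ≤ G.stageValue u h s a₁ (f₂ s a₁)) := by
  have h1 : ∀ s, ∃ a₁, ∀ a₂, G.stageValue u h s a₁ a₂ ≤ G.bellman u h s := by
    intro s
    obtain ⟨a₁, -, h⟩ := Finset.exists_mem_eq_inf' Finset.univ_nonempty fun a₁ =>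
      Finset.univ.sup' Finset.univ_nonempty fun a₂ => G.stageValue u h s a₁ a₂
    exact ⟨a₁, fun a₂ => (Finset.le_sup' _ (Finset.mem_univ a₂)).trans_eq h.symm⟩
  have h2 : ∀ s a₁, ∃ a₂, G.bellman u h s ≤ G.stageValue u h s a₁ a₂ := by
    intro s a₁
    obtain ⟨a₂, -, h⟩ := Finset.exists_mem_eq_sup' Finset.univ_nonempty fun a₂ =>
      G.stageValue u h s a₁ a₂
    exact ⟨a₂, (Finset.inf'_le _ (Finset.mem_univ a₁)).trans_eq h⟩
  choose f₁ hf₁ using h1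
  choose f₂ hf₂ using h2
  exact ⟨f₁, f₂, hf₁, hf₂⟩

/-- Pit the minimizer for `h'` against the maximizing reply for `h`. This combines monotonicity with
equivariance under adding constants; `c` may be negative. -/
theorem bellman_le_of_le (G : StackelbergGame S A₁ A₂ K) (u : EuclideanSpace ℝ (Fin K))
    {h h' : S → ℝ} {c : ℝ} (hc : ∀ s, h s ≤ h' s + c) (s : S) :
    G.bellman u h s ≤ G.bellman u h' s + c := by
  obtain ⟨f₁, -, hf₁, -⟩ := G.exists_selectors u h'
  obtain ⟨-, f₂, -, hf₂⟩ := G.exists_selectors u h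
  refine (hf₂ s (f₁ s)).trans ((?_ : _ ≤ _).trans
    (add_le_add_left (hf₁ s (f₂ s (f₁ s))) c))
  have := (G.trans s (f₁ s) (f₂ s (f₁ s))).expect_mono hc
  rw [PMF.expect_add, PMF.expect_const] at this
  simp only [stageValue]
  linarith

theorem dist_bellman_le (G : StackelbergGame S A₁ A₂ K) (u : EuclideanSpace ℝ (Fin K))
    (h h' : S → ℝ) : dist (G.bellman u h) (G.bellman u h') ≤ dist h h' := by
  refine (dist_pi_le_iff dist_nonneg).2 fun s => ?_
  have hd : ∀ s, |h s - h' s| ≤ dist h h' := fun s => dist_le_pi_dist h h' s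
  rw [Real.dist_eq, abs_le]
  have h1 := G.bellman_le_of_le u (fun s => by linarith [(abs_le.1 (hd s)).2] :
    ∀ s, h s ≤ h' s + dist h h') s
  have h2 := G.bellman_le_of_le u (fun s => by linarith [(abs_le.1 (hd s)).1] :
    ∀ s, h' s ≤ h s + dist h h') s
  constructor <;> linarith

theorem continuous_bellman (G : StackelbergGame S A₁ A₂ K) (u : EuclideanSpace ℝ (Fin K)) :
    Continuous (G.bellman u) :=
  (LipschitzWith.of_dist_le_mul (K := 1) fun h h' => by
    simpa using G.dist_bellman_le u h h').continuous

/-- The discounted Bellman equation has a solution. -/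
theorem exists_discounted (G : StackelbergGame S A₁ A₂ K) (u : EuclideanSpace ℝ (Fin K)) {β : ℝ}
    (hβ0 : 0 ≤ β) (hβ1 : β < 1) :
    ∃ V : S → ℝ, G.bellman u (fun s => β * V s) = V := by
  have hc : ContractingWith ⟨β, hβ0⟩ fun V : S → ℝ => G.bellman u (fun s => β * V s) := by
    refine ⟨hβ1, LipschitzWith.of_dist_le_mul fun V V' => (G.dist_bellman_le u _ _).trans ?_⟩
    refine (dist_pi_le_iff (mul_nonneg hβ0 dist_nonneg)).2 fun s => ?_
    rw [Real.dist_eq, ← mul_sub, abs_mul, abs_of_nonneg hβ0]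
    exact mul_le_mul_of_nonneg_left (dist_le_pi_dist V V' s) hβ0
  exact ⟨_, hc.fixedPoint_isFixedPt⟩

variable [Nonempty S]

/-- Subtracting its minimum from the discounted value `V` turns the discounted equation into one
with `W = V - min V` and `v = (1 - β) min V`. Neither bound depends on `β` or `u`, which provides
compactness as `β → 1`. -/
theorem exists_relative_discounted (G : StackelbergGame S A₁ A₂ K) (hG : G.Irreducible) :
    ∃ R H : ℝ, 0 ≤ H ∧ ∀ u : EuclideanSpace ℝ (Fin K), ‖u‖ ≤ 1 → ∀ β : ℝ, 1 / 2 ≤ β → β < 1 →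
      ∃ (v : ℝ) (W : S → ℝ), v ∈ Set.Icc (-R) R ∧ (∀ s, W s ∈ Set.Icc 0 H) ∧
        ∀ s, G.bellman u (fun s => β * W s) s = v + W s := by
  obtain ⟨B, hB0, hB⟩ := G.exists_cost_bound
  obtain ⟨C, hC0, hC⟩ := G.exists_oscillation_bound hG
  refine ⟨B, C * (2 * B), by positivity, fun u hu β hβ hβ1 => ?_⟩
  obtain ⟨V, hV⟩ := G.exists_discounted u (by linarith : 0 ≤ β) hβ1
  obtain ⟨i, hi⟩ := Finite.exists_min V
  have hr : ∀ s a₁ a₂, |inner ℝ (G.cost s a₁ a₂) u| ≤ B := fun s a₁ a₂ =>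
    (abs_real_inner_le_norm _ _).trans <|
      (mul_le_mul (hB s a₁ a₂) hu (norm_nonneg _) hB0).trans_eq (mul_one B)
  have hVs := congrFun hV
  obtain ⟨f₁, f₂, hf₁, hf₂⟩ := G.exists_selectors u fun s => β * V s
  simp only [hVs] at hf₁ hf₂
  -- Evaluate the equation at the minimum of `V`; for the upper bound, at its maximum.
  have hlow : -B ≤ (1 - β) * V i := by
    have h1 := hf₁ i (f₂ i (f₁ i))
    have h2 := (G.trans i (f₁ i) (f₂ i (f₁ i))).const_le_expect (f := fun s => β * V s)
      (c := β * V i) fun s => mul_le_mul_of_nonneg_left (hi s) (by linarith)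
    have h3 := (abs_le.1 (hr i (f₁ i) (f₂ i (f₁ i)))).1
    simp only [stageValue] at h1
    linarith
  have hup : (1 - β) * V i ≤ B := by
    obtain ⟨j, hj⟩ := Finite.exists_max V
    have h1 := hf₂ j (f₁ j)
    have h2 := (G.trans j (f₁ j) (f₂ j (f₁ j))).expect_le_const (f := fun s => β * V s)
      (c := β * V j) fun s => mul_le_mul_of_nonneg_left (hj s) (by linarith)
    have h3 := (abs_le.1 (hr j (f₁ j) (f₂ j (f₁ j)))).2
    simp only [stageValue] at h1
    have h4 : (1 - β) * V i ≤ (1 - β) * V j := mul_le_mul_of_nonneg_left (hi j) (by linarith)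
    linarith
  have hshift : ∀ s a₁ a₂, G.stageValue u (fun s => β * V s) s a₁ a₂ =
      G.stageValue u (fun s => β * (V s - V i)) s a₁ a₂ + β * V i := by
    intro s a₁ a₂
    have : (fun s => β * (V s - V i)) = fun s => β * V s - β * V i := by ext; ring
    simp only [stageValue]
    rw [this, PMF.expect_sub, PMF.expect_const]
    ring
  refine ⟨(1 - β) * V i, fun s => V s - V i, ⟨hlow, hup⟩, fun s => ⟨by linarith [hi s], ?_⟩, ?_⟩
  -- The error `2 * B` comes from a stage cost of at least `-B` and from `(1 - β) * V i ≤ B`.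
  · refine hC f₁ f₂ β (2 * B) (fun s => V s - V i) hβ hβ1.le (by positivity)
      (fun s => by linarith [hi s]) ⟨i, sub_self _⟩ (fun s => ?_) s
    have h1 := hf₁ s (f₂ s (f₁ s))
    rw [hshift, stageValue, PMF.expect_const_mul] at h1
    have h3 := (abs_le.1 (hr s (f₁ s) (f₂ s (f₁ s)))).1
    linarith
  · intro s
    have h1 := G.bellman_le_of_le u (h := fun s => β * (V s - V i)) (h' := fun s => β * V s)
      (c := -(β * V i)) (fun s => by linarith) s
    have h2 := G.bellman_le_of_le u (h := fun s => β * V s) (h' := fun s => β * (V s - V i))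
      (c := β * V i) (fun s => by linarith) s
    rw [hVs] at h1 h2
    linarith

/-- The average-cost optimality equation is solvable, with a relative value function bounded
uniformly over the directions in the unit ball. -/
theorem exists_isOptimal (G : StackelbergGame S A₁ A₂ K) (hG : G.Irreducible) :
    ∃ H : ℝ, 0 ≤ H ∧ ∀ u : EuclideanSpace ℝ (Fin K), ‖u‖ ≤ 1 →
      ∃ (v : ℝ) (h : S → ℝ) (f₁ : S → A₁) (f₂ : S → A₁ → A₂), (∀ s, h s ∈ Set.Icc 0 H) ∧
        G.IsOptimal u v h f₁ f₂ := by
  obtain ⟨R, H, hH, hRH⟩ := G.exists_relative_discounted hG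
  refine ⟨H, hH, fun u hu => ?_⟩
  -- The offset `2` keeps every discount factor in `[1/2, 1)`.
  have hβ : ∀ n : ℕ, (1 / 2 : ℝ) ≤ 1 - 1 / (n + 2) ∧ (1 : ℝ) - 1 / (n + 2) < 1 := by
    intro n
    have h1 : (1 : ℝ) / (n + 2) ≤ 1 / 2 :=
      one_div_le_one_div_of_le (by norm_num) (by linarith [n.cast_nonneg (α := ℝ)])
    have h2 : (0 : ℝ) < 1 / (n + 2) := by positivity
    constructor <;> linarith
  choose v W hv hW hvW using fun n : ℕ => hRH u hu _ (hβ n).1 (hβ n).2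
  have hK : IsCompact (Set.Icc (-R) R ×ˢ Set.univ.pi fun _ : S => Set.Icc (0 : ℝ) H) :=
    isCompact_Icc.prod (isCompact_univ_pi fun _ => isCompact_Icc)
  obtain ⟨⟨v', h⟩, hmem, φ, hφ, hlim⟩ := hK.tendsto_subseq (x := fun n => (v n, W n))
    fun n => ⟨hv n, fun s _ => hW n s⟩
  have hlv : Tendsto (fun n => v (φ n)) atTop (𝓝 v') := (Prod.tendsto_iff _ _).1 hlim |>.1
  have hlW : Tendsto (fun n => W (φ n)) atTop (𝓝 h) := (Prod.tendsto_iff _ _).1 hlim |>.2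
  have hlβ : Tendsto (fun n : ℕ => (1 : ℝ) - 1 / ((φ n : ℝ) + 2)) atTop (𝓝 1) := by
    have h1 : Tendsto (fun n : ℕ => (1 : ℝ) / ((n : ℝ) + 2)) atTop (𝓝 0) := by
      have := (tendsto_add_atTop_iff_nat 1).2 (tendsto_one_div_add_atTop_nhds_zero_nat (𝕜 := ℝ))
      refine this.congr fun n => ?_
      push_cast
      ring
    simpa using (h1.comp hφ.tendsto_atTop).const_sub 1
  have hβW : Tendsto (fun n s => ((1 : ℝ) - 1 / ((φ n : ℝ) + 2)) * W (φ n) s) atTop (𝓝 h) := by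
    refine tendsto_pi_nhds.2 fun s => ?_
    simpa using hlβ.mul (tendsto_pi_nhds.1 hlW s)
  have hlim1 := ((G.continuous_bellman u).tendsto h).comp hβW
  have heq : ∀ s, G.bellman u h s = v' + h s := fun s =>
    tendsto_nhds_unique ((tendsto_pi_nhds.1 hlim1 s).congr fun n => hvW (φ n) s)
      (hlv.add (tendsto_pi_nhds.1 hlW s))
  obtain ⟨f₁, f₂, hf₁, hf₂⟩ := G.exists_selectors u h
  exact ⟨v', h, f₁, f₂, fun s => hmem.2 s (Set.mem_univ s),
    fun s a₂ => (hf₁ s a₂).trans_eq (heq s), fun s a₁ => (heq s).symm.trans_le (hf₂ s a₁)⟩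

end StackelbergGame

/-! ### Occupation measures and the min-max value -/

namespace StackelbergGame

variable {S A₁ A₂ : Type*} [Fintype S] {K : ℕ}

theorem exists_isOccupation [Nonempty S] (G : StackelbergGame S A₁ A₂ K) (π₁ : S → PMF A₁)
    (π₂ : S → A₁ → PMF A₂) : ∃ ψ, G.IsOccupation π₁ π₂ ψ := by
  obtain ⟨η, hη⟩ := PMF.exists_bind_eq_self fun s => G.nextState (stageLaw (PMF.pure s) π₁ π₂)
  refine ⟨_, η, ?_, rfl⟩
  conv_rhs => rw [← hη]
  simp only [nextState, stageLaw, PMF.bind_bind, PMF.pure_bind]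

variable [Fintype A₁] [Fintype A₂]

theorem inner_ergodicCost (G : StackelbergGame S A₁ A₂ K) (ψ : PMF (Stage S A₁ A₂))
    (u : EuclideanSpace ℝ (Fin K)) :
    inner ℝ (G.ergodicCost ψ) u =
      ψ.expect fun z => inner ℝ (G.cost z.state z.act₁ z.act₂) u := by
  simp only [ergodicCost, PMF.expect, Stage.sum_eq, sum_inner, real_inner_smul_left]

/-- Against an invariant law the continuation values cancel. -/
theorem IsOccupation.inner_ergodicCost_eq {G : StackelbergGame S A₁ A₂ K} {π₁ : S → PMF A₁}
    {π₂ : S → A₁ → PMF A₂} {ψ : PMF (Stage S A₁ A₂)} (hψ : G.IsOccupation π₁ π₂ ψ)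
    (u : EuclideanSpace ℝ (Fin K)) (h : S → ℝ) :
    ∃ η : PMF S, inner ℝ (G.ergodicCost ψ) u =
      η.expect fun s => (π₁ s).expect fun a₁ => (π₂ s a₁).expect fun a₂ =>
        G.stageValue u h s a₁ a₂ - h s := by
  obtain ⟨η, hη, rfl⟩ := hψ
  refine ⟨η, ?_⟩
  have h1 : (stageLaw η π₁ π₂).expect (fun z => (G.trans z.state z.act₁ z.act₂).expect h) =
      (stageLaw η π₁ π₂).expect fun z => h z.state := by
    rw [← PMF.expect_bind]
    change (G.nextState _).expect h = _
    rw [hη, expect_stageLaw]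
    simp only [PMF.expect_const]
  rw [inner_ergodicCost]
  have h2 := expect_stageLaw η π₁ π₂
    fun z => G.stageValue u h z.state z.act₁ z.act₂ - h z.state
  refine Eq.trans ?_ h2
  simp only [stageValue]
  rw [PMF.expect_sub, PMF.expect_add, h1, add_sub_cancel_right]

namespace IsOptimal

variable {G : StackelbergGame S A₁ A₂ K} {u : EuclideanSpace ℝ (Fin K)} {v : ℝ} {h : S → ℝ}
  {f₁ : S → A₁} {f₂ : S → A₁ → A₂}

/-- Average the optimality inequality over the invariant law: `h` cancels and only `v` remains. The
follower's bound is the mirror image. -/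
theorem inner_ergodicCost_le (ho : G.IsOptimal u v h f₁ f₂) {π₂ : S → A₁ → PMF A₂}
    {ψ : PMF (Stage S A₁ A₂)} (hψ : G.IsOccupation (fun s => PMF.pure (f₁ s)) π₂ ψ) :
    inner ℝ (G.ergodicCost ψ) u ≤ v := by
  obtain ⟨η, hη⟩ := hψ.inner_ergodicCost_eq u h
  rw [hη]
  refine PMF.expect_le_const _ fun s => ?_
  rw [PMF.expect_pure]
  exact PMF.expect_le_const _ fun a₂ => by linarith [ho.le s a₂]

theorem le_inner_ergodicCost (ho : G.IsOptimal u v h f₁ f₂) {π₁ : S → PMF A₁}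
    {ψ : PMF (Stage S A₁ A₂)}
    (hψ : G.IsOccupation π₁ (fun s a₁ => PMF.pure (f₂ s a₁)) ψ) :
    v ≤ inner ℝ (G.ergodicCost ψ) u := by
  obtain ⟨η, hη⟩ := hψ.inner_ergodicCost_eq u h
  rw [hη]
  refine PMF.const_le_expect _ fun s => PMF.const_le_expect _ fun a₁ => ?_
  rw [PMF.expect_pure]
  linarith [ho.ge s a₁]

end IsOptimal

/-- Ensures that the supremum in `worstCost` is genuine and not the default value `0` of an
unbounded set. -/
theorem bddAbove_inner_ergodicCost (G : StackelbergGame S A₁ A₂ K)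
    (u : EuclideanSpace ℝ (Fin K)) (π₁ : S → PMF A₁) :
    BddAbove {r | ∃ (π₂ : S → A₁ → PMF A₂) (ψ : PMF (Stage S A₁ A₂)),
      G.IsOccupation π₁ π₂ ψ ∧ r = inner ℝ (G.ergodicCost ψ) u} := by
  obtain ⟨B, hB0, hB⟩ := G.exists_cost_bound
  refine ⟨B * ‖u‖, ?_⟩
  rintro _ ⟨π₂, ψ, -, rfl⟩
  rw [inner_ergodicCost]
  exact ψ.expect_le_const fun z => (real_inner_le_norm _ _).trans
    (mul_le_mul_of_nonneg_right (hB _ _ _) (norm_nonneg u))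

namespace IsOptimal

variable [Nonempty S] {G : StackelbergGame S A₁ A₂ K} {u : EuclideanSpace ℝ (Fin K)} {v : ℝ}
  {h : S → ℝ} {f₁ : S → A₁} {f₂ : S → A₁ → A₂}

theorem le_worstCost (ho : G.IsOptimal u v h f₁ f₂) (π₁ : S → PMF A₁) :
    v ≤ G.worstCost u π₁ := by
  obtain ⟨ψ, hψ⟩ := G.exists_isOccupation π₁ fun s a₁ => PMF.pure (f₂ s a₁)
  exact (ho.le_inner_ergodicCost hψ).trans
    (le_csSup (G.bddAbove_inner_ergodicCost u π₁) ⟨_, ψ, hψ, rfl⟩)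

theorem worstCost_eq (ho : G.IsOptimal u v h f₁ f₂) :
    G.worstCost u (fun s => PMF.pure (f₁ s)) = v := by
  refine le_antisymm ?_ (ho.le_worstCost _)
  obtain ⟨ψ, hψ⟩ := G.exists_isOccupation (fun s => PMF.pure (f₁ s)) fun s a₁ => PMF.pure (f₂ s a₁)
  refine csSup_le ⟨_, _, ψ, hψ, rfl⟩ ?_
  rintro _ ⟨π₂, ψ', hψ', rfl⟩
  exact ho.inner_ergodicCost_le hψ'

theorem minMaxValue_eq (ho : G.IsOptimal u v h f₁ f₂) : G.minMaxValue u = v := by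
  refine le_antisymm ?_ ?_
  · rw [← ho.worstCost_eq]
    exact ciInf_le ⟨v, by rintro _ ⟨π₁, rfl⟩; exact ho.le_worstCost π₁⟩ _
  · have : Nonempty (S → PMF A₁) := ⟨fun s => PMF.pure (f₁ s)⟩
    exact le_ciInf ho.le_worstCost

/-- The pair `(f₁, f₂)` is a saddle: `f₁` guarantees at most `v` against every reply, `f₂` at least
`v` against every leader strategy. -/
theorem exists_mem_minMaxOccupations (ho : G.IsOptimal u v h f₁ f₂) :
    ∃ ψ ∈ G.minMaxOccupations u, inner ℝ (G.ergodicCost ψ) u = v := by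
  obtain ⟨ψ, hψ⟩ := G.exists_isOccupation (fun s => PMF.pure (f₁ s)) fun s a₁ => PMF.pure (f₂ s a₁)
  exact ⟨ψ, ⟨_, _, hψ, fun π₁ => ho.worstCost_eq.trans_le (ho.le_worstCost π₁),
    fun π₂ ψ' hψ' => (ho.inner_ergodicCost_le hψ').trans (ho.le_inner_ergodicCost hψ)⟩,
    le_antisymm (ho.inner_ergodicCost_le hψ) (ho.le_inner_ergodicCost hψ)⟩

end IsOptimal

theorem minMaxOccupations_subset (G : StackelbergGame S A₁ A₂ K)
    (u : EuclideanSpace ℝ (Fin K)) : G.minMaxOccupations u ⊆ G.ergodicOccupations := by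
  rintro ψ ⟨π₁, π₂, hψ, -⟩
  exact ⟨π₁, π₂, hψ⟩

end StackelbergGame

/-! ### One-step conditioning along the play -/

namespace StackelbergGame

variable {S A₁ A₂ : Type*} [Fintype S] [Fintype A₁] [Fintype A₂] {K : ℕ}

/-- A functional of plays that only depends on the stages `0, …, n`. -/
def DependsUpTo {Z α : Type*} (n : ℕ) (F : (ℕ → Z) → α) : Prop :=
  ∀ ω ω', (∀ i ≤ n, ω i = ω' i) → F ω = F ω'

/-- Later coordinates are filled with an arbitrary value. When `Z` is finite so is the history
space, whence measurability, boundedness and integrability below. -/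
theorem DependsUpTo.exists_eq_comp {Z α : Type*} [Nonempty Z] {n : ℕ} {F : (ℕ → Z) → α}
    (hF : DependsUpTo n F) :
    ∃ f : (Finset.Iic n → Z) → α, ∀ ω, F ω = f (Preorder.frestrictLe (π := fun _ => Z) n ω) := by
  classical
  obtain ⟨z⟩ := ‹Nonempty Z›
  refine ⟨fun x => F fun i => if hi : i ∈ Finset.Iic n then x ⟨i, hi⟩ else z,
    fun ω => hF _ _ fun i hi => ?_⟩
  simp [hi]

theorem DependsUpTo.comp {Z α β : Type*} {n : ℕ} {F : (ℕ → Z) → α} (hF : DependsUpTo n F)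
    (f : α → β) : DependsUpTo n fun ω => f (F ω) := fun ω ω' h => congrArg f (hF ω ω' h)

instance (G : StackelbergGame S A₁ A₂ K) (σ₁ : LeaderStrategy S A₁ A₂)
    (σ₂ : FollowerStrategy S A₁ A₂) (s₀ : S) : IsProbabilityMeasure (G.law σ₁ σ₂ s₀) := by
  have : IsProbabilityMeasure
    (stageLaw (PMF.pure s₀) (σ₁ 0 Fin.elim0) (σ₂ 0 Fin.elim0)).toMeasure :=
    PMF.toMeasure.isProbabilityMeasure _
  unfold law
  infer_instance

theorem dependsUpTo_expect_nextStage (G : StackelbergGame S A₁ A₂ K)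
    (σ₁ : LeaderStrategy S A₁ A₂) (σ₂ : FollowerStrategy S A₁ A₂) {n : ℕ}
    {F : (ℕ → Stage S A₁ A₂) → Stage S A₁ A₂ → ℝ} (hF : DependsUpTo n F) :
    DependsUpTo n fun ω => (G.nextStage σ₁ σ₂ n fun i => ω i).expect (F ω) := by
  intro ω ω' hω
  have h : (fun i : Fin (n + 1) => ω i) = fun i : Fin (n + 1) => ω' i :=
    funext fun i => hω i (Nat.lt_succ_iff.1 i.2)
  simp only [hF ω ω' hω, h]

variable [Nonempty S] [Nonempty A₁] [Nonempty A₂]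

theorem DependsUpTo.measurable {α : Type*} [MeasurableSpace α] {n : ℕ}
    {F : (ℕ → Stage S A₁ A₂) → α} (hF : DependsUpTo n F) : Measurable F := by
  obtain ⟨f, hf⟩ := hF.exists_eq_comp
  rw [funext hf]
  exact (measurable_of_countable f).comp (Preorder.measurable_frestrictLe n)

theorem DependsUpTo.exists_bound {n : ℕ} {F : (ℕ → Stage S A₁ A₂) → ℝ} (hF : DependsUpTo n F) :
    ∃ C, ∀ ω, ‖F ω‖ ≤ C := by
  obtain ⟨f, hf⟩ := hF.exists_eq_comp
  obtain ⟨C, hC⟩ := (Set.finite_range fun x => ‖f x‖).bddAbove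
  exact ⟨C, fun ω => by rw [hf]; exact hC ⟨_, rfl⟩⟩

theorem DependsUpTo.integrable {n : ℕ} {F : (ℕ → Stage S A₁ A₂) → ℝ} (hF : DependsUpTo n F)
    (μ : Measure (ℕ → Stage S A₁ A₂)) [IsFiniteMeasure μ] : Integrable F μ := by
  obtain ⟨C, hC⟩ := hF.exists_bound
  exact Integrable.of_bound hF.measurable.aestronglyMeasurable C (.of_forall hC)

/-- The conditional law of stage `n + 1` given the past is `nextStage`. -/
theorem integral_law_succ (G : StackelbergGame S A₁ A₂ K) (σ₁ : LeaderStrategy S A₁ A₂)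
    (σ₂ : FollowerStrategy S A₁ A₂) (s₀ : S) {n : ℕ}
    {F : (ℕ → Stage S A₁ A₂) → Stage S A₁ A₂ → ℝ} (hF : DependsUpTo n F) :
    ∫ ω, F ω (ω (n + 1)) ∂(G.law σ₁ σ₂ s₀) =
      ∫ ω, (G.nextStage σ₁ σ₂ n fun i => ω i).expect (F ω) ∂(G.law σ₁ σ₂ s₀) := by
  obtain ⟨f, hf⟩ := hF.exists_eq_comp
  set μ := G.law σ₁ σ₂ s₀ with hμ
  have : IsProbabilityMeasure
    (stageLaw (PMF.pure s₀) (σ₁ 0 Fin.elim0) (σ₂ 0 Fin.elim0)).toMeasure :=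
    PMF.toMeasure.isProbabilityMeasure _
  -- The joint law of the history up to `n` and stage `n + 1` is the history law composed with the
  -- step kernel.
  have key := Kernel.map_frestrictLe_trajMeasure_compProd_eq_map_trajMeasure
    (X := fun _ => Stage S A₁ A₂) (κ := G.stepKernel σ₁ σ₂)
    (μ₀ := (stageLaw (PMF.pure s₀) (σ₁ 0 Fin.elim0) (σ₂ 0 Fin.elim0)).toMeasure) (a := n)
  change μ.map _ ⊗ₘ _ = μ.map _ at key
  set φ : (Finset.Iic n → Stage S A₁ A₂) × Stage S A₁ A₂ → ℝ := fun x => f x.1 x.2 with hφ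
  have hφm : Measurable φ := measurable_of_countable φ
  have hpair : Measurable fun ω : ℕ → Stage S A₁ A₂ =>
      (Preorder.frestrictLe (π := fun _ => Stage S A₁ A₂) n ω, ω (n + 1)) :=
    (Preorder.measurable_frestrictLe n).prodMk (measurable_pi_apply _)
  have h1 : ∫ ω, F ω (ω (n + 1)) ∂μ = ∫ x, φ x ∂(μ.map fun ω =>
      (Preorder.frestrictLe (π := fun _ => Stage S A₁ A₂) n ω, ω (n + 1))) := by
    rw [integral_map hpair.aemeasurable hφm.aestronglyMeasurable]
    simp only [hφ, hf]
  rw [h1, ← key]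
  have : IsProbabilityMeasure
      (μ.map (Preorder.frestrictLe (π := fun _ => Stage S A₁ A₂) n)) :=
    Measure.isProbabilityMeasure_map (Preorder.measurable_frestrictLe n).aemeasurable
  rw [Measure.integral_compProd, integral_map]
  · refine integral_congr_ae (.of_forall fun ω => ?_)
    simp only [hφ, hf]
    change ∫ z, _ ∂(PMF.toMeasure _) = _
    rw [PMF.integral_eq_sum]
    rfl
  · exact (Preorder.measurable_frestrictLe n).aemeasurable
  · exact (measurable_of_countable _).aestronglyMeasurable
  · obtain ⟨C, hC⟩ := (Set.finite_range fun x => ‖φ x‖).bddAbove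
    exact Integrable.of_bound hφm.aestronglyMeasurable C (.of_forall fun x => hC ⟨x, rfl⟩)

end StackelbergGame

/-! ### Projection onto `D` and supporting directions -/

section Projection

variable {K : ℕ} {D : Set (EuclideanSpace ℝ (Fin K))}

theorem norm_sub_projPoint (hc : IsClosed D) (hne : D.Nonempty) (x : EuclideanSpace ℝ (Fin K)) :
    ‖x - projPoint D x‖ = Metric.infDist x D := by
  rw [(projPoint_spec hc hne x).2, dist_eq_norm]

theorem norm_smul_steerDir (x : EuclideanSpace ℝ (Fin K)) :
    ‖x - projPoint D x‖ • steerDir D x = x - projPoint D x := by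
  by_cases h : ‖x - projPoint D x‖ = 0
  · rw [h, zero_smul, norm_eq_zero.1 h]
  · rw [steerDir, smul_smul, mul_inv_cancel₀ h, one_smul]

/-- An inequality, because the direction is zero when `x` is its own nearest point; the scalar games
can thus be solved at every `x` without a case distinction. -/
theorem norm_steerDir_le (x : EuclideanSpace ℝ (Fin K)) : ‖steerDir D x‖ ≤ 1 := by
  rw [steerDir, norm_smul, norm_inv, norm_norm]
  exact inv_mul_le_one

/-- The variational characterization of the projection; the argument uses convexity of `D` only
here. -/
theorem inner_steerDir_le (hc : IsClosed D) (hne : D.Nonempty) (hconv : Convex ℝ D)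
    (x : EuclideanSpace ℝ (Fin K)) {y : EuclideanSpace ℝ (Fin K)} (hy : y ∈ D) :
    inner ℝ y (steerDir D x) ≤ inner ℝ (projPoint D x) (steerDir D x) := by
  have hmin : ‖x - projPoint D x‖ = ⨅ w : D, ‖x - w‖ := by
    rw [norm_sub_projPoint hc hne, Metric.infDist_eq_iInf]
    simp only [dist_eq_norm]
  have h := (norm_eq_iInf_iff_real_inner_le_zero hconv (projPoint_spec hc hne x).1).1 hmin y hy
  rw [← sub_nonpos, ← inner_sub_left, steerDir, real_inner_smul_right, real_inner_comm]
  exact mul_nonpos_of_nonneg_of_nonpos (by positivity) h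

theorem inner_le_add_infDist (hne : D.Nonempty) {u y : EuclideanSpace ℝ (Fin K)} {b : ℝ}
    (hu : ‖u‖ ≤ 1) (hD : ∀ z ∈ D, inner ℝ z u ≤ b) : inner ℝ y u ≤ b + Metric.infDist y D := by
  rw [← sub_le_iff_le_add']
  refine (Metric.le_infDist hne).2 fun z hz => ?_
  have h1 : inner ℝ (y - z) u ≤ ‖y - z‖ :=
    (real_inner_le_norm _ _).trans (mul_le_of_le_one_right (norm_nonneg _) hu)
  rw [inner_sub_left] at h1
  rw [dist_eq_norm]
  linarith [hD z hz]

end Projection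

/-! ### Necessity: the follower's guarantee -/

namespace StackelbergGame

variable {S A₁ A₂ : Type*} {K : ℕ}

/-- The cost of a stage. -/
def stageCost (G : StackelbergGame S A₁ A₂ K) (z : Stage S A₁ A₂) : EuclideanSpace ℝ (Fin K) :=
  G.cost z.state z.act₁ z.act₂

theorem smul_avgCost (G : StackelbergGame S A₁ A₂ K) (ω : ℕ → Stage S A₁ A₂) (n : ℕ) :
    (n : ℝ) • G.avgCost ω n = ∑ i ∈ Finset.range n, G.stageCost (ω (i + 1)) := by
  rcases eq_or_ne n 0 with rfl | hn
  · simp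
  rw [avgCost, smul_smul, mul_inv_cancel₀ (Nat.cast_ne_zero.2 hn), one_smul,
    Finset.range_eq_Ico, Finset.sum_Ico_add' (fun i => G.stageCost (ω i)) 0 n 1]
  rfl

theorem dependsUpTo_avgCost (G : StackelbergGame S A₁ A₂ K) {k n : ℕ} (hk : k ≤ n) :
    DependsUpTo n fun ω => G.avgCost ω k := by
  intro ω ω' h
  simp only [avgCost]
  congr 1
  exact Finset.sum_congr rfl fun m hm => by rw [h m ((Finset.mem_Icc.1 hm).2.trans hk)]

theorem norm_avgCost_le (G : StackelbergGame S A₁ A₂ K) {B : ℝ} (hB0 : 0 ≤ B)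
    (hB : ∀ s a₁ a₂, ‖G.cost s a₁ a₂‖ ≤ B) (ω : ℕ → Stage S A₁ A₂) (n : ℕ) :
    ‖G.avgCost ω n‖ ≤ B := by
  rcases Nat.eq_zero_or_pos n with rfl | hn
  · simpa [avgCost] using hB0
  have hn' : (0 : ℝ) < n := Nat.cast_pos.2 hn
  refine le_of_mul_le_mul_left ?_ hn'
  calc (n : ℝ) * ‖G.avgCost ω n‖ = ‖(n : ℝ) • G.avgCost ω n‖ := by
        rw [norm_smul, Real.norm_of_nonneg hn'.le]
    _ ≤ ∑ i ∈ Finset.range n, B := by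
        rw [smul_avgCost]
        exact norm_sum_le_of_le _ fun _ _ => hB _ _ _
    _ = n * B := by simp

/-- The same strategy works, which already settles the half-space claim. Non-emptiness matters
because `infDist` to the empty set is `0`. -/
theorem approachable_mono {G : StackelbergGame S A₁ A₂ K}
    {D D' : Set (EuclideanSpace ℝ (Fin K))} [Fintype S] [Fintype A₁] [Fintype A₂]
    (hD : G.Approachable D) (hne : D.Nonempty)
    (h : D ⊆ D') : G.Approachable D' := by
  obtain ⟨σ₁, hσ⟩ := hD
  refine ⟨σ₁, fun σ₂ s₀ => (hσ σ₂ s₀).mono fun ω hω => ?_⟩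
  exact squeeze_zero (fun _ => Metric.infDist_nonneg)
    (fun _ => Metric.infDist_le_infDist_of_subset h hne) hω

variable [Fintype S]

/-- The expected value of `h` at the state following the stage `z`. -/
noncomputable def continuation (G : StackelbergGame S A₁ A₂ K) (h : S → ℝ)
    (z : Stage S A₁ A₂) : ℝ :=
  (G.trans z.state z.act₁ z.act₂).expect h

variable [Fintype A₁] [Fintype A₂]

/-- A bound valid after the reply `f₂` to each leader action survives averaging over any law of that
action. This is the submartingale step; `expect_nextStage_le` is its counterpart for the leader. -/
theorem expect_nextStage_ge (G : StackelbergGame S A₁ A₂ K) {σ₁ : LeaderStrategy S A₁ A₂}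
    {σ₂ : FollowerStrategy S A₁ A₂} {n : ℕ} {x : Fin (n + 1) → Stage S A₁ A₂}
    {f₂ : S → A₁ → A₂} (hσ₂ : ∀ s a₁, σ₂ (n + 1) x s a₁ = PMF.pure (f₂ s a₁))
    {h : S → ℝ} {q : Stage S A₁ A₂ → ℝ} (hq : ∀ s a₁, h s ≤ q ⟨s, a₁, f₂ s a₁⟩) :
    G.continuation h (x (Fin.last n)) ≤ (G.nextStage σ₁ σ₂ n x).expect q := by
  rw [nextStage, expect_stageLaw]
  refine PMF.expect_mono _ fun s => PMF.const_le_expect _ fun a₁ => ?_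
  rw [hσ₂, PMF.expect_pure]
  exact hq s a₁

theorem expect_nextStage_le (G : StackelbergGame S A₁ A₂ K) {σ₁ : LeaderStrategy S A₁ A₂}
    {σ₂ : FollowerStrategy S A₁ A₂} {n : ℕ} {x : Fin (n + 1) → Stage S A₁ A₂}
    {f₁ : S → A₁} (hσ₁ : ∀ s, σ₁ (n + 1) x s = PMF.pure (f₁ s))
    {h : S → ℝ} {q : Stage S A₁ A₂ → ℝ} (hq : ∀ s a₂, q ⟨s, f₁ s, a₂⟩ ≤ h s) :
    (G.nextStage σ₁ σ₂ n x).expect q ≤ G.continuation h (x (Fin.last n)) := by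
  rw [nextStage, expect_stageLaw]
  refine PMF.expect_mono _ fun s => ?_
  rw [hσ₁, PMF.expect_pure]
  exact PMF.expect_le_const _ fun a₂ => hq s a₂

variable [Nonempty S] [Nonempty A₁] [Nonempty A₂]

/-- If the follower plays an optimal pure stationary strategy, the expected accumulated cost in
direction `u` is at least `n v` up to a constant. -/
theorem IsOptimal.le_integral_sum {G : StackelbergGame S A₁ A₂ K}
    {u : EuclideanSpace ℝ (Fin K)} {v : ℝ} {h : S → ℝ} {f₁ : S → A₁} {f₂ : S → A₁ → A₂}
    (ho : G.IsOptimal u v h f₁ f₂) (h0 : ∀ s, 0 ≤ h s) (σ₁ : LeaderStrategy S A₁ A₂) (s₀ : S)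
    (n : ℕ) :
    n * v ≤ ∫ ω, ((∑ i ∈ Finset.range n, inner ℝ (G.stageCost (ω (i + 1))) u) +
      G.continuation h (ω n)) ∂(G.law σ₁ (fun _ _ s a₁ => PMF.pure (f₂ s a₁)) s₀) := by
  set μ := G.law σ₁ (fun _ _ s a₁ => PMF.pure (f₂ s a₁)) s₀ with hμ
  have hdep : ∀ n, DependsUpTo n fun ω : ℕ → Stage S A₁ A₂ =>
      ∑ i ∈ Finset.range n, inner ℝ (G.stageCost (ω (i + 1))) u := fun n ω ω' hω =>
    Finset.sum_congr rfl fun i hi => by rw [hω (i + 1) (Finset.mem_range.1 hi)]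
  induction n with
  | zero =>
    simp only [Nat.cast_zero, zero_mul, Finset.range_zero, Finset.sum_empty, zero_add]
    exact integral_nonneg fun ω => PMF.const_le_expect _ h0
  | succ n ih =>
    -- The cost and continuation of the new stage together form `stageValue`, so the optimality
    -- equation gains `v` in conditional expectation.
    set F : (ℕ → Stage S A₁ A₂) → Stage S A₁ A₂ → ℝ := fun ω z =>
      (∑ i ∈ Finset.range n, inner ℝ (G.stageCost (ω (i + 1))) u) +
        G.stageValue u h z.state z.act₁ z.act₂ with hF
    have hFd : DependsUpTo n F := (hdep n).comp fun t (z : Stage S A₁ A₂) =>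
      t + G.stageValue u h z.state z.act₁ z.act₂
    have h1 := G.integral_law_succ σ₁ (fun _ _ s a₁ => PMF.pure (f₂ s a₁)) s₀ hFd
    have h2 : ∀ ω : ℕ → Stage S A₁ A₂, F ω (ω (n + 1)) =
        (∑ i ∈ Finset.range (n + 1), inner ℝ (G.stageCost (ω (i + 1))) u) +
          G.continuation h (ω (n + 1)) := by
      intro ω
      rw [Finset.sum_range_succ, add_assoc]
      rfl
    simp only [h2] at h1
    rw [h1]
    have hi : Integrable (fun ω => (∑ i ∈ Finset.range n,
        inner ℝ (G.stageCost (ω (i + 1))) u) + G.continuation h (ω n)) μ :=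
      DependsUpTo.integrable (n := n) (fun ω ω' hω => by
        simp only [hdep n ω ω' hω, hω n le_rfl]) μ
    have h3 : ((n + 1 : ℕ) : ℝ) * v ≤ ∫ ω, ((∑ i ∈ Finset.range n,
        inner ℝ (G.stageCost (ω (i + 1))) u) + G.continuation h (ω n) + v) ∂μ := by
      rw [integral_add hi (integrable_const v), integral_const, probReal_univ, one_smul]
      push_cast
      linarith
    refine h3.trans (integral_mono (hi.add (integrable_const v)) ?_ fun ω => ?_)
    · exact (G.dependsUpTo_expect_nextStage _ _ hFd).integrable μ
    · simp only [hF]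
      rw [PMF.expect_add, PMF.expect_const]
      have h4 := G.expect_nextStage_ge (σ₁ := σ₁) (σ₂ := fun _ _ s a₁ => PMF.pure (f₂ s a₁))
        (x := fun i : Fin (n + 1) => ω i) (f₂ := f₂) (fun _ _ => rfl) (h := fun s => v + h s)
        (q := fun z => G.stageValue u h z.state z.act₁ z.act₂) fun s a₁ => ho.ge s a₁
      have h5 : G.continuation (fun s => v + h s) (ω n) = v + G.continuation h (ω n) := by
        simp only [continuation, PMF.expect_add, PMF.expect_const]
      simp only [Fin.val_last] at h4
      rw [h5] at h4
      linarith

/-- The value of the scalar game in a direction bounding an approachable set. -/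
theorem IsOptimal.le_of_approachable {G : StackelbergGame S A₁ A₂ K}
    {u : EuclideanSpace ℝ (Fin K)} {v : ℝ} {h : S → ℝ} {f₁ : S → A₁} {f₂ : S → A₁ → A₂}
    (ho : G.IsOptimal u v h f₁ f₂) {H : ℝ} (hH : ∀ s, h s ∈ Set.Icc 0 H) (hu : ‖u‖ ≤ 1)
    {D : Set (EuclideanSpace ℝ (Fin K))} (hne : D.Nonempty) (hD : G.Approachable D) {b : ℝ}
    (hb : ∀ z ∈ D, inner ℝ z u ≤ b) : v ≤ b := by
  obtain ⟨σ₁, hσ⟩ := hD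
  obtain ⟨s₀⟩ := ‹Nonempty S›
  have hlim := hσ (fun _ _ s a₁ => PMF.pure (f₂ s a₁)) s₀
  have hsum := ho.le_integral_sum (fun s => (hH s).1) σ₁ s₀
  set μ := G.law σ₁ (fun _ _ s a₁ => PMF.pure (f₂ s a₁)) s₀ with hμ
  obtain ⟨B, hB0, hB⟩ := G.exists_cost_bound
  obtain ⟨d, hd⟩ := hne
  have hdep : ∀ n, DependsUpTo n fun ω => Metric.infDist (G.avgCost ω n) D := fun n =>
    (G.dependsUpTo_avgCost le_rfl).comp fun y => Metric.infDist y D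
  have hint : Tendsto (fun n => ∫ ω, Metric.infDist (G.avgCost ω n) D ∂μ) atTop (𝓝 0) := by
    have := tendsto_integral_of_dominated_convergence (μ := μ) (f := fun _ => (0 : ℝ))
      (F := fun n ω => Metric.infDist (G.avgCost ω n) D) (fun _ => B + ‖d‖)
      (fun n => (hdep n).measurable.aestronglyMeasurable) (integrable_const _)
      (fun n => .of_forall fun ω => ?_) hlim
    · simpa using this
    · rw [Real.norm_of_nonneg Metric.infDist_nonneg]
      refine (Metric.infDist_le_dist_of_mem hd).trans ?_
      rw [dist_eq_norm]
      exact (norm_sub_le _ _).trans (add_le_add_left (G.norm_avgCost_le hB0 hB ω n) _)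
  -- The follower's lower bound `n * v` meets the upper bound from `D`; dividing by `n` makes the
  -- continuation term `H / n`.
  have hbound : ∀ n : ℕ, 0 < n →
      v ≤ b + ∫ ω, Metric.infDist (G.avgCost ω n) D ∂μ + H / n := by
    intro n hn
    have hn' : (0 : ℝ) < n := Nat.cast_pos.2 hn
    have h1 : ∫ ω, ((∑ i ∈ Finset.range n, inner ℝ (G.stageCost (ω (i + 1))) u) +
        G.continuation h (ω n)) ∂μ ≤
          ∫ ω, (n * b + H + n * Metric.infDist (G.avgCost ω n) D) ∂μ := by
      refine integral_mono ?_ ?_ fun ω => ?_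
      · refine DependsUpTo.integrable (n := n) (fun ω ω' hω => ?_) μ
        rw [hω n le_rfl]
        congr 1
        exact Finset.sum_congr rfl fun i hi => by rw [hω (i + 1) (Finset.mem_range.1 hi)]
      · exact ((hdep n).comp fun t => n * b + H + n * t).integrable μ
      · have h2 : G.continuation h (ω n) ≤ H := PMF.expect_le_const _ fun s => (hH s).2
        have h3 : ∑ i ∈ Finset.range n, inner ℝ (G.stageCost (ω (i + 1))) u =
            n * inner ℝ (G.avgCost ω n) u := by
          rw [← sum_inner, ← smul_avgCost, real_inner_smul_left]
        have h4 := mul_le_mul_of_nonneg_left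
          (inner_le_add_infDist ⟨d, hd⟩ hu hb (y := G.avgCost ω n)) hn'.le
        simp only [h3]
        linarith
    rw [integral_add (integrable_const _) (((hdep n).integrable μ).const_mul _), integral_const,
      probReal_univ, one_smul, integral_const_mul] at h1
    have h5 := (hsum n).trans h1
    refine le_of_mul_le_mul_left ?_ hn'
    have h6 : (n : ℝ) * (H / n) = H := mul_div_cancel₀ _ hn'.ne'
    rw [mul_add, mul_add, h6]
    linarith
  have hlim2 : Tendsto (fun n : ℕ => b + ∫ ω, Metric.infDist (G.avgCost ω n) D ∂μ + H / n)
      atTop (𝓝 (b + 0 + 0)) :=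
    (hint.const_add b).add (tendsto_const_div_atTop_nhds_zero_nat H)
  rw [add_zero, add_zero] at hlim2
  exact ge_of_tendsto hlim2 ((eventually_gt_atTop 0).mono hbound)

end StackelbergGame

/-! ### Sufficiency: almost sure convergence and steering in blocks -/

/-- Non-negative functions with summable integrals tend to zero almost surely. -/
theorem ae_tendsto_zero_of_summable_integral {Ω : Type*} [MeasurableSpace Ω] {μ : Measure Ω}
    {f : ℕ → Ω → ℝ} (hf : ∀ n, Integrable (f n) μ) (hm : ∀ n, Measurable (f n))
    (h0 : ∀ n ω, 0 ≤ f n ω)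
    {a : ℕ → ℝ} (ha : Summable a) (hle : ∀ n, ∫ ω, f n ω ∂μ ≤ a n) :
    ∀ᵐ ω ∂μ, Tendsto (fun n => f n ω) atTop (𝓝 0) := by
  have hm' : ∀ n, Measurable fun ω => ENNReal.ofReal (f n ω) := fun n => (hm n).ennreal_ofReal
  have hfin : ∫⁻ ω, ∑' n, ENNReal.ofReal (f n ω) ∂μ ≠ ⊤ := by
    rw [lintegral_tsum fun n => (hm' n).aemeasurable]
    refine ne_top_of_le_ne_top ha.tsum_ofReal_ne_top (ENNReal.tsum_le_tsum fun n => ?_)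
    rw [← ofReal_integral_eq_lintegral_ofReal (hf n) (.of_forall (h0 n))]
    exact ENNReal.ofReal_le_ofReal (hle n)
  filter_upwards [ae_lt_top (Measurable.tsum hm') hfin] with ω hω
  have := (ENNReal.tendsto_toReal ENNReal.zero_ne_top).comp
    (ENNReal.tendsto_atTop_zero_of_tsum_ne_top hω.ne)
  refine (this.congr fun n => ?_)
  simp [ENNReal.toReal_ofReal (h0 n ω)]

namespace StackelbergGame

variable {S A₁ A₂ : Type*} {K : ℕ}

/-- Time times deviation from a fixed point is additive. Used with `p` the old projection for the
square expansion, and with `p` the old average to bound its displacement. -/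
theorem smul_avgCost_add (G : StackelbergGame S A₁ A₂ K) (ω : ℕ → Stage S A₁ A₂) (n i : ℕ)
    (p : EuclideanSpace ℝ (Fin K)) :
    ((n + i : ℕ) : ℝ) • (G.avgCost ω (n + i) - p) = (n : ℝ) • (G.avgCost ω n - p) +
      ∑ j ∈ Finset.range i, (G.stageCost (ω (n + j + 1)) - p) := by
  rw [smul_sub, smul_sub, smul_avgCost, smul_avgCost, Finset.sum_range_add,
    Finset.sum_sub_distrib, Finset.sum_const, Finset.card_range, Nat.cast_add, add_smul,
    Nat.cast_smul_eq_nsmul ℝ i]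
  abel

/-- Convergence along fourth powers implies convergence of the distance to `D`. -/
theorem tendsto_infDist_of_pow_four (G : StackelbergGame S A₁ A₂ K) {B : ℝ} (hB0 : 0 ≤ B)
    (hB : ∀ s a₁ a₂, ‖G.cost s a₁ a₂‖ ≤ B) {D : Set (EuclideanSpace ℝ (Fin K))}
    {ω : ℕ → Stage S A₁ A₂}
    (h : Tendsto (fun j : ℕ => Metric.infDist (G.avgCost ω (j ^ 4)) D) atTop (𝓝 0)) :
    Tendsto (fun n => Metric.infDist (G.avgCost ω n) D) atTop (𝓝 0) := by
  have hsqrt : Tendsto Nat.sqrt atTop atTop :=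
    tendsto_atTop.2 fun b => (eventually_ge_atTop (b ^ 2)).mono fun n hn => Nat.le_sqrt'.2 hn
  have hroot : Tendsto (fun n => Nat.sqrt (Nat.sqrt n)) atTop atTop := hsqrt.comp hsqrt
  have hratio : Tendsto (fun j : ℕ => 2 * B * ((1 + 1 / (j : ℝ)) ^ 4 - 1)) atTop (𝓝 0) := by
    have h1 : Tendsto (fun j : ℕ => 1 / (j : ℝ)) atTop (𝓝 0) :=
      tendsto_const_div_atTop_nhds_zero_nat 1
    have h2 := (((h1.const_add 1).pow 4).sub_const 1).const_mul (2 * B)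
    simpa using h2
  have hsum := (h.add hratio).comp hroot
  rw [add_zero] at hsum
  refine squeeze_zero' (.of_forall fun _ => Metric.infDist_nonneg) ?_ hsum
  filter_upwards [eventually_ge_atTop 1] with n hn
  set j := Nat.sqrt (Nat.sqrt n) with hj
  have hj1 : 1 ≤ j := Nat.le_sqrt'.2 (Nat.le_sqrt'.2 (by simpa using hn))
  have hjn : j ^ 4 ≤ n := by
    calc j ^ 4 = (j ^ 2) ^ 2 := by ring
      _ ≤ (Nat.sqrt n) ^ 2 := Nat.pow_le_pow_left (Nat.sqrt_le' _) 2
      _ ≤ n := Nat.sqrt_le' n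
  have hnj : n ≤ (j + 1) ^ 4 := by
    have h1 : Nat.sqrt n + 1 ≤ (j + 1) ^ 2 := Nat.lt_succ_sqrt' (Nat.sqrt n)
    calc n ≤ (Nat.sqrt n + 1) ^ 2 := (Nat.lt_succ_sqrt' n).le
      _ ≤ ((j + 1) ^ 2) ^ 2 := Nat.pow_le_pow_left h1 2
      _ = (j + 1) ^ 4 := by ring
  obtain ⟨i, hi⟩ := Nat.exists_eq_add_of_le hjn
  have hjpos : (0 : ℝ) < j := Nat.cast_pos.2 hj1
  have hnpos : (0 : ℝ) < n := Nat.cast_pos.2 hn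
  -- At most `(j + 1) ^ 4 - j ^ 4` stages intervene, each adding a deviation of at most `2 * B`, and
  -- consecutive fourth powers have ratio tending to one.
  have hmove : ‖G.avgCost ω n - G.avgCost ω (j ^ 4)‖ ≤ 2 * B * ((1 + 1 / (j : ℝ)) ^ 4 - 1) := by
    have h1 := G.smul_avgCost_add ω (j ^ 4) i (G.avgCost ω (j ^ 4))
    rw [← hi, sub_self, smul_zero, zero_add] at h1
    have h2 : (n : ℝ) * ‖G.avgCost ω n - G.avgCost ω (j ^ 4)‖ ≤ i * (2 * B) := by
      rw [← Real.norm_of_nonneg hnpos.le, ← norm_smul, h1]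
      refine (norm_sum_le_of_le _ fun l _ => (norm_sub_le _ _).trans
        (add_le_add (hB _ _ _) (G.norm_avgCost_le hB0 hB ω _))).trans_eq ?_
      simp only [Finset.sum_const, Finset.card_range, nsmul_eq_mul]
      ring
    have h3 : (i : ℝ) ≤ (j + 1) ^ 4 - j ^ 4 := by
      have h4 : (n : ℝ) ≤ (j + 1) ^ 4 := by exact_mod_cast hnj
      have h5 : (n : ℝ) = j ^ 4 + i := by exact_mod_cast hi
      linarith
    have h6 : (j : ℝ) ^ 4 ≤ n := by exact_mod_cast hjn
    have h7 : (1 + 1 / (j : ℝ)) ^ 4 - 1 = ((j + 1) ^ 4 - j ^ 4) / j ^ 4 := by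
      field_simp
    rw [h7, ← mul_div_assoc, le_div_iff₀ (by positivity)]
    calc _ ≤ ‖G.avgCost ω n - G.avgCost ω (j ^ 4)‖ * n :=
          mul_le_mul_of_nonneg_left h6 (norm_nonneg _)
      _ ≤ i * (2 * B) := by rwa [mul_comm]
      _ ≤ ((j + 1) ^ 4 - j ^ 4) * (2 * B) := mul_le_mul_of_nonneg_right h3 (by positivity)
      _ = _ := by ring
  calc Metric.infDist (G.avgCost ω n) D
      ≤ Metric.infDist (G.avgCost ω (j ^ 4)) D + dist (G.avgCost ω n) (G.avgCost ω (j ^ 4)) :=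
        Metric.infDist_le_infDist_add_dist
    _ ≤ _ := by rw [dist_eq_norm]; exact add_le_add_right hmove _

variable [Nonempty S] [Nonempty A₁] [Nonempty A₂]

/-- The leader's strategy which during the stages `k² + 1, …, (k + 1)²` plays the pure stationary
strategy `f y` for the average cost `y` at time `k²`. -/
noncomputable def blockStrategy (G : StackelbergGame S A₁ A₂ K)
    (f : EuclideanSpace ℝ (Fin K) → S → A₁) : LeaderStrategy S A₁ A₂ := fun m x s =>
  -- The average is read at a time at most `m - 1`, so the default stage has no effect; at `m = 0`
  -- the average is the empty one.
  PMF.pure (f (G.avgCost (fun i => if hi : i < m then x ⟨i, hi⟩ else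
    ⟨Classical.arbitrary S, Classical.arbitrary A₁, Classical.arbitrary A₂⟩)
      (Nat.sqrt (m - 1) ^ 2)) s)

theorem blockStrategy_succ (G : StackelbergGame S A₁ A₂ K)
    (f : EuclideanSpace ℝ (Fin K) → S → A₁) (n : ℕ) (ω : ℕ → Stage S A₁ A₂) (s : S) :
    G.blockStrategy f (n + 1) (fun i => ω i) s =
      PMF.pure (f (G.avgCost ω (Nat.sqrt n ^ 2)) s) := by
  have h := G.dependsUpTo_avgCost (Nat.sqrt_le' n) (fun i => if hi : i < n + 1 then ω i else
    ⟨Classical.arbitrary S, Classical.arbitrary A₁, Classical.arbitrary A₂⟩) ω fun i hi => by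
      simp [Nat.lt_succ_of_le hi]
  simp only at h
  simp only [blockStrategy, Nat.add_sub_cancel, h]

variable [Fintype S] [Fintype A₁] [Fintype A₂]

/-- Steering towards `D`: from the direction-wise value bounds to a drift inequality for the
unnormalized direction `x - P_D(x)`. -/
theorem exists_steering (G : StackelbergGame S A₁ A₂ K) (hG : G.Irreducible)
    {D : Set (EuclideanSpace ℝ (Fin K))} (hne : D.Nonempty) (hc : IsClosed D)
    (hD : ∀ x ∉ D, G.minMaxValue (steerDir D x) ≤ inner ℝ (projPoint D x) (steerDir D x)) :
    ∃ H : ℝ, 0 ≤ H ∧ ∀ x : EuclideanSpace ℝ (Fin K), ∃ (f₁ : S → A₁) (h : S → ℝ),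
      (∀ s, h s ∈ Set.Icc 0 (H * ‖x - projPoint D x‖)) ∧
      ∀ s a₂, inner ℝ (G.cost s (f₁ s) a₂ - projPoint D x) (x - projPoint D x) +
        (G.trans s (f₁ s) a₂).expect h ≤ h s := by
  obtain ⟨H, hH, hopt⟩ := G.exists_isOptimal hG
  refine ⟨H, hH, fun x => ?_⟩
  obtain ⟨v, h, f₁, f₂, hh, ho⟩ := hopt _ (norm_steerDir_le (D := D) x)
  -- Scaling by the distance extends the hypothesis to points of `D`, where both sides vanish.
  have hv : ‖x - projPoint D x‖ * v ≤
      ‖x - projPoint D x‖ * inner ℝ (projPoint D x) (steerDir D x) := by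
    by_cases hx : x ∈ D
    · rw [norm_sub_projPoint hc hne, Metric.infDist_zero_of_mem hx, zero_mul, zero_mul]
    · exact mul_le_mul_of_nonneg_left (ho.minMaxValue_eq.symm.trans_le (hD x hx))
        (norm_nonneg (x - projPoint D x))
  refine ⟨f₁, fun s => ‖x - projPoint D x‖ * h s,
    fun s => ⟨mul_nonneg (norm_nonneg (x - projPoint D x)) (hh s).1, ?_⟩, fun s a₂ => ?_⟩
  · rw [mul_comm H]
    exact mul_le_mul_of_nonneg_left (hh s).2 (norm_nonneg (x - projPoint D x))
  · have h1 := mul_le_mul_of_nonneg_left (ho.le s a₂) (norm_nonneg (x - projPoint D x))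
    have h2 : inner ℝ (G.cost s (f₁ s) a₂ - projPoint D x) (x - projPoint D x) =
        ‖x - projPoint D x‖ * (inner ℝ (G.cost s (f₁ s) a₂) (steerDir D x) -
          inner ℝ (projPoint D x) (steerDir D x)) := by
      conv_lhs => rw [← norm_smul_steerDir (D := D) x]
      rw [real_inner_smul_right, inner_sub_left]
    rw [stageValue] at h1
    rw [h2, PMF.expect_const_mul]
    linarith

/-- Over a block the expected cost relative to `p y`, in direction `y - p y`, is controlled by the
continuation value at the start of the block. -/
theorem integral_block_le (G : StackelbergGame S A₁ A₂ K)
    {f : EuclideanSpace ℝ (Fin K) → S → A₁} {h : EuclideanSpace ℝ (Fin K) → S → ℝ}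
    {p : EuclideanSpace ℝ (Fin K) → EuclideanSpace ℝ (Fin K)}
    (hstep : ∀ x s a₂, inner ℝ (G.cost s (f x s) a₂ - p x) (x - p x) +
        (G.trans s (f x s) a₂).expect (h x) ≤ h x s)
    (σ₂ : FollowerStrategy S A₁ A₂) (s₀ : S) (k i : ℕ) (hi : i ≤ 2 * k + 1) :
    ∫ ω, ((∑ j ∈ Finset.range i, inner ℝ (G.stageCost (ω (k ^ 2 + j + 1)) -
        p (G.avgCost ω (k ^ 2))) (G.avgCost ω (k ^ 2) - p (G.avgCost ω (k ^ 2)))) +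
        G.continuation (h (G.avgCost ω (k ^ 2))) (ω (k ^ 2 + i)))
        ∂(G.law (G.blockStrategy f) σ₂ s₀) ≤
      ∫ ω, G.continuation (h (G.avgCost ω (k ^ 2))) (ω (k ^ 2))
        ∂(G.law (G.blockStrategy f) σ₂ s₀) := by
  set μ := G.law (G.blockStrategy f) σ₂ s₀ with hμ
  have hdep : ∀ i, DependsUpTo (k ^ 2 + i) fun ω : ℕ → Stage S A₁ A₂ =>
      ∑ j ∈ Finset.range i, inner ℝ (G.stageCost (ω (k ^ 2 + j + 1)) -
        p (G.avgCost ω (k ^ 2))) (G.avgCost ω (k ^ 2) - p (G.avgCost ω (k ^ 2))) := by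
    intro i ω ω' hω
    have h1 := G.dependsUpTo_avgCost (Nat.le_add_right (k ^ 2) i) ω ω' hω
    simp only at h1
    simp only [h1]
    exact Finset.sum_congr rfl fun j hj => by
      rw [hω (k ^ 2 + j + 1) (by have := Finset.mem_range.1 hj; omega)]
  induction i with
  | zero => simp
  | succ i ih =>
    refine le_trans ?_ (ih (by omega))
    set F : (ℕ → Stage S A₁ A₂) → Stage S A₁ A₂ → ℝ := fun ω z =>
      (∑ j ∈ Finset.range i, inner ℝ (G.stageCost (ω (k ^ 2 + j + 1)) -
        p (G.avgCost ω (k ^ 2))) (G.avgCost ω (k ^ 2) - p (G.avgCost ω (k ^ 2)))) +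
        (inner ℝ (G.stageCost z - p (G.avgCost ω (k ^ 2)))
          (G.avgCost ω (k ^ 2) - p (G.avgCost ω (k ^ 2))) +
        G.continuation (h (G.avgCost ω (k ^ 2))) z) with hF
    have hFd : DependsUpTo (k ^ 2 + i) F := by
      intro ω ω' hω
      have h1 := G.dependsUpTo_avgCost (Nat.le_add_right (k ^ 2) i) ω ω' hω
      have h2 := hdep i ω ω' hω
      simp only at h1 h2
      simp only [hF, h2]
      simp only [h1]
    have h1 := G.integral_law_succ (G.blockStrategy f) σ₂ s₀ hFd
    have h2 : ∀ ω : ℕ → Stage S A₁ A₂, F ω (ω (k ^ 2 + i + 1)) =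
        (∑ j ∈ Finset.range (i + 1), inner ℝ (G.stageCost (ω (k ^ 2 + j + 1)) -
          p (G.avgCost ω (k ^ 2))) (G.avgCost ω (k ^ 2) - p (G.avgCost ω (k ^ 2)))) +
          G.continuation (h (G.avgCost ω (k ^ 2))) (ω (k ^ 2 + (i + 1))) := by
      intro ω
      rw [Finset.sum_range_succ, add_assoc (Finset.sum _ _)]
      rfl
    simp only [h2] at h1
    rw [hμ, h1]
    refine integral_mono ((G.dependsUpTo_expect_nextStage _ _ hFd).integrable _) ?_ fun ω => ?_
    · refine DependsUpTo.integrable (n := k ^ 2 + i) (fun ω ω' hω => ?_) _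
      have h3 := G.dependsUpTo_avgCost (Nat.le_add_right (k ^ 2) i) ω ω' hω
      have h4 := hdep i ω ω' hω
      simp only at h3 h4
      simp only [h4]
      simp only [h3, hω _ le_rfl]
    · simp only [hF]
      rw [PMF.expect_add, PMF.expect_const]
      -- Here `i ≤ 2 * k`, so stage `k ^ 2 + i + 1` lies in the block and the selector is still the
      -- one frozen at time `k ^ 2`.
      have hk : Nat.sqrt (k ^ 2 + i) = k := Nat.sqrt_add_eq' k (by omega)
      have h4 := G.expect_nextStage_le (σ₁ := G.blockStrategy f) (σ₂ := σ₂) (n := k ^ 2 + i)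
        (x := fun i => ω i) (f₁ := f (G.avgCost ω (k ^ 2)))
        (fun s => by rw [blockStrategy_succ, hk]) (h := h (G.avgCost ω (k ^ 2)))
        (q := fun z => inner ℝ (G.stageCost z - p (G.avgCost ω (k ^ 2)))
          (G.avgCost ω (k ^ 2) - p (G.avgCost ω (k ^ 2))) +
          G.continuation (h (G.avgCost ω (k ^ 2))) z) fun s a₂ => hstep _ s a₂
      simp only [Fin.val_last] at h4
      exact add_le_add_right h4 _

end StackelbergGame

/-! ### Sufficiency: the mean square recursion -/

namespace StackelbergGame

variable {S A₁ A₂ : Type*} {K : ℕ}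

/-- Blackwell's estimate: the old projection is a competitor in `D` for the new distance. Expanding
the square leaves the drift as cross term and a crude bound on the block's own contribution. -/
theorem sq_infDist_block_le (G : StackelbergGame S A₁ A₂ K) {D : Set (EuclideanSpace ℝ (Fin K))}
    (hne : D.Nonempty) (hc : IsClosed D) {M : ℝ} (ω : ℕ → Stage S A₁ A₂) (n i : ℕ)
    (hM : ∀ z, ‖G.stageCost z - projPoint D (G.avgCost ω n)‖ ≤ M) :
    (((n + i : ℕ) : ℝ) * Metric.infDist (G.avgCost ω (n + i)) D) ^ 2 ≤
      (n * Metric.infDist (G.avgCost ω n) D) ^ 2 +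
      2 * n * (∑ j ∈ Finset.range i, inner ℝ (G.stageCost (ω (n + j + 1)) -
        projPoint D (G.avgCost ω n)) (G.avgCost ω n - projPoint D (G.avgCost ω n))) +
      (i * M) ^ 2 := by
  set p := projPoint D (G.avgCost ω n) with hp
  set z := ∑ j ∈ Finset.range i, (G.stageCost (ω (n + j + 1)) - p) with hz
  have hp' := projPoint_spec hc hne (G.avgCost ω n)
  have h1 : ((n + i : ℕ) : ℝ) * Metric.infDist (G.avgCost ω (n + i)) D ≤
      ‖(n : ℝ) • (G.avgCost ω n - p) + z‖ := by
    rw [hz, ← smul_avgCost_add, norm_smul, Real.norm_of_nonneg (Nat.cast_nonneg _), ← dist_eq_norm]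
    exact mul_le_mul_of_nonneg_left (Metric.infDist_le_dist_of_mem hp'.1) (Nat.cast_nonneg _)
  have h2 : ‖z‖ ≤ i * M := (norm_sum_le_of_le _ fun j _ => hM _).trans_eq (by simp)
  have h3 : ‖(n : ℝ) • (G.avgCost ω n - p)‖ = n * Metric.infDist (G.avgCost ω n) D := by
    rw [norm_smul, Real.norm_of_nonneg (Nat.cast_nonneg _), norm_sub_projPoint hc hne]
  refine (pow_le_pow_left₀ (mul_nonneg (Nat.cast_nonneg _) Metric.infDist_nonneg) h1 2).trans ?_
  rw [norm_add_sq_real, h3, real_inner_smul_left, real_inner_comm, ← sum_inner, mul_assoc 2]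
  exact add_le_add_right (pow_le_pow_left₀ (norm_nonneg _) h2 2) _

variable [Fintype S] [Fintype A₁] [Fintype A₂] [Nonempty S] [Nonempty A₁] [Nonempty A₂]

/-- The mean square distance to `D` at time `k²` under a block strategy with a drift inequality
towards `D`. -/
theorem exists_integral_sq_infDist_le (G : StackelbergGame S A₁ A₂ K)
    {D : Set (EuclideanSpace ℝ (Fin K))} (hne : D.Nonempty) (hc : IsClosed D)
    {f : EuclideanSpace ℝ (Fin K) → S → A₁} {h : EuclideanSpace ℝ (Fin K) → S → ℝ} {H : ℝ}
    (hH0 : 0 ≤ H) (hH : ∀ x s, h x s ∈ Set.Icc 0 (H * ‖x - projPoint D x‖))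
    (hstep : ∀ x s a₂, inner ℝ (G.cost s (f x s) a₂ - projPoint D x) (x - projPoint D x) +
        (G.trans s (f x s) a₂).expect (h x) ≤ h x s) :
    ∃ C : ℝ, ∀ (σ₂ : FollowerStrategy S A₁ A₂) (s₀ : S) (k : ℕ), 0 < k →
      ∫ ω, Metric.infDist (G.avgCost ω (k ^ 2)) D ^ 2 ∂(G.law (G.blockStrategy f) σ₂ s₀) ≤
        C / k := by
  obtain ⟨B, hB0, hB⟩ := G.exists_cost_bound
  obtain ⟨d, hd⟩ := hne
  have hne : D.Nonempty := ⟨d, hd⟩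
  set L := B + ‖d‖ with hL
  have hL0 : 0 ≤ L := by positivity
  set M := B + (B + L) with hM
  have hM0 : 0 ≤ M := by positivity
  set C := 2 * (H * L) + 4 * M ^ 2 with hC
  have hC0 : 0 ≤ C := by positivity
  have hdist : ∀ ω n, ‖G.avgCost ω n - projPoint D (G.avgCost ω n)‖ ≤ L := by
    intro ω n
    rw [norm_sub_projPoint hc hne]
    refine (Metric.infDist_le_dist_of_mem hd).trans ?_
    rw [dist_eq_norm]
    exact (norm_sub_le _ _).trans (add_le_add_left (G.norm_avgCost_le hB0 hB ω n) _)
  have hstage : ∀ ω n z, ‖G.stageCost z - projPoint D (G.avgCost ω n)‖ ≤ M := by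
    intro ω n z
    refine (norm_sub_le _ _).trans (add_le_add (hB _ _ _) ?_)
    rw [← sub_sub_cancel (G.avgCost ω n) (projPoint D (G.avgCost ω n))]
    exact (norm_sub_le _ _).trans (add_le_add (G.norm_avgCost_le hB0 hB ω n) (hdist ω n))
  refine ⟨C, fun σ₂ s₀ => ?_⟩
  set μ := G.law (G.blockStrategy f) σ₂ s₀ with hμ
  set W : ℕ → (ℕ → Stage S A₁ A₂) → ℝ := fun n ω =>
    (n * Metric.infDist (G.avgCost ω n) D) ^ 2 with hW
  have hWi : ∀ n, Integrable (W n) μ := fun n =>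
    ((G.dependsUpTo_avgCost le_rfl).comp fun y => (n * Metric.infDist y D) ^ 2).integrable μ
  have hcont : ∀ k n, k ≤ n → DependsUpTo n fun ω : ℕ → Stage S A₁ A₂ =>
      G.continuation (h (G.avgCost ω k)) (ω n) := by
    intro k n hk ω ω' hω
    have h1 := G.dependsUpTo_avgCost hk ω ω' hω
    simp only at h1
    simp only [h1, hω n le_rfl]
  have hsumd : ∀ n i, DependsUpTo (n + i) fun ω : ℕ → Stage S A₁ A₂ =>
      ∑ j ∈ Finset.range i, inner ℝ (G.stageCost (ω (n + j + 1)) -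
        projPoint D (G.avgCost ω n)) (G.avgCost ω n - projPoint D (G.avgCost ω n)) := by
    intro n i ω ω' hω
    have h1 := G.dependsUpTo_avgCost (Nat.le_add_right n i) ω ω' hω
    simp only at h1
    simp only [h1]
    exact Finset.sum_congr rfl fun j hj => by
      rw [hω (n + j + 1) (by have := Finset.mem_range.1 hj; omega)]
  -- The bound does not grow with the block: the initial continuation is at most `H * L` and the
  -- final one, being nonnegative, is dropped.
  have hblock : ∀ k : ℕ, ∫ ω, (∑ j ∈ Finset.range (2 * k + 1),
      inner ℝ (G.stageCost (ω (k ^ 2 + j + 1)) - projPoint D (G.avgCost ω (k ^ 2)))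
        (G.avgCost ω (k ^ 2) - projPoint D (G.avgCost ω (k ^ 2)))) ∂μ ≤ H * L := by
    intro k
    have h1 := G.integral_block_le hstep σ₂ s₀ k (2 * k + 1) le_rfl
    have h2 : ∫ ω, G.continuation (h (G.avgCost ω (k ^ 2))) (ω (k ^ 2)) ∂μ ≤ H * L := by
      refine (integral_mono ((hcont _ _ le_rfl).integrable μ) (integrable_const (H * L))
        fun ω => ?_).trans_eq (by simp)
      exact PMF.expect_le_const _ fun s => (hH _ s).2.trans
        (mul_le_mul_of_nonneg_left (hdist ω _) hH0)
    refine le_trans ?_ (h1.trans h2)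
    refine integral_mono ((hsumd _ _).integrable μ)
      (((hsumd _ _).integrable μ).add ((hcont _ _ (Nat.le_add_right _ _)).integrable μ)) fun ω => ?_
    exact le_add_of_nonneg_right (PMF.const_le_expect _ fun s => (hH _ s).1)
  -- Drift and square terms of a block each grow like `k²`, so `W` grows by at most `C * (k + 1) ^ 2
  -- ≤ C * ((k + 1) ^ 3 - k ^ 3)`. Dividing by `k ^ 4` then gives `C / k`.
  have hrec : ∀ k : ℕ, ∫ ω, W (k ^ 2) ω ∂μ ≤ C * (k : ℝ) ^ 3 := by
    intro k
    induction k with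
    | zero => simp [hW]
    | succ k ih =>
      have hk : (k + 1) ^ 2 = k ^ 2 + (2 * k + 1) := by ring
      have hi : Integrable (fun ω => W (k ^ 2) ω + 2 * (k ^ 2 : ℕ) *
          (∑ j ∈ Finset.range (2 * k + 1), inner ℝ (G.stageCost (ω (k ^ 2 + j + 1)) -
            projPoint D (G.avgCost ω (k ^ 2)))
              (G.avgCost ω (k ^ 2) - projPoint D (G.avgCost ω (k ^ 2))))) μ :=
        (hWi _).add (((hsumd _ _).integrable μ).const_mul _)
      have h1 : ∫ ω, W ((k + 1) ^ 2) ω ∂μ ≤ ∫ ω, (W (k ^ 2) ω + 2 * (k ^ 2 : ℕ) *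
          (∑ j ∈ Finset.range (2 * k + 1), inner ℝ (G.stageCost (ω (k ^ 2 + j + 1)) -
            projPoint D (G.avgCost ω (k ^ 2)))
              (G.avgCost ω (k ^ 2) - projPoint D (G.avgCost ω (k ^ 2)))) +
          ((2 * k + 1 : ℕ) * M) ^ 2) ∂μ := by
        refine integral_mono (hWi _) (hi.add (integrable_const _)) fun ω => ?_
        rw [hk]
        exact G.sq_infDist_block_le hne hc ω _ _ (hstage ω _)
      rw [integral_add hi (integrable_const _), integral_add (hWi _) (((hsumd _ _).integrable μ).const_mul _),
        integral_const_mul, integral_const, probReal_univ, one_smul] at h1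
      have h2 := mul_le_mul_of_nonneg_left (hblock k)
        (by positivity : (0 : ℝ) ≤ 2 * (k ^ 2 : ℕ))
      push_cast at h1 h2 ⊢
      have hk0 : (0 : ℝ) ≤ k := k.cast_nonneg
      have h3 : 2 * (k : ℝ) ^ 2 * (H * L) ≤ 2 * (H * L) * (k + 1) ^ 2 := by
        have : 0 ≤ H * L := by positivity
        nlinarith
      have h4 : ((2 * (k : ℝ) + 1) * M) ^ 2 ≤ 4 * M ^ 2 * (k + 1) ^ 2 := by
        nlinarith [sq_nonneg M, mul_nonneg hk0 (sq_nonneg M)]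
      have h5 : C * (k + 1 : ℝ) ^ 2 ≤ C * ((k + 1) ^ 3 - k ^ 3) :=
        mul_le_mul_of_nonneg_left (by nlinarith) hC0
      have h6 : C * (k + 1 : ℝ) ^ 2 = 2 * (H * L) * (k + 1) ^ 2 + 4 * M ^ 2 * (k + 1) ^ 2 := by
        rw [hC]; ring
      linarith
  intro k hk
  have hk' : (0 : ℝ) < k := Nat.cast_pos.2 hk
  have h1 := hrec k
  have h2 : ∫ ω, W (k ^ 2) ω ∂μ =
      (k : ℝ) ^ 4 * ∫ ω, Metric.infDist (G.avgCost ω (k ^ 2)) D ^ 2 ∂μ := by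
    rw [← integral_const_mul]
    refine integral_congr_ae (.of_forall fun ω => ?_)
    simp only [hW]
    push_cast
    ring
  rw [h2] at h1
  rw [le_div_iff₀ hk']
  refine le_of_mul_le_mul_left ?_ (pow_pos hk' 3)
  linarith

/-- Sufficiency of the direction-wise condition for approachability. -/
theorem approachable_of_minMaxValue_le (G : StackelbergGame S A₁ A₂ K) (hG : G.Irreducible)
    {D : Set (EuclideanSpace ℝ (Fin K))} (hne : D.Nonempty) (hc : IsClosed D)
    (hD : ∀ x ∉ D, G.minMaxValue (steerDir D x) ≤ inner ℝ (projPoint D x) (steerDir D x)) :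
    G.Approachable D := by
  obtain ⟨H, hH0, hsteer⟩ := G.exists_steering hG hne hc hD
  choose f h hH hstep using hsteer
  obtain ⟨C, hC⟩ := G.exists_integral_sq_infDist_le hne hc hH0 hH hstep
  obtain ⟨B, hB0, hB⟩ := G.exists_cost_bound
  refine ⟨G.blockStrategy f, fun σ₂ s₀ => ?_⟩
  have hdep : ∀ n, DependsUpTo n fun ω => Metric.infDist (G.avgCost ω n) D ^ 2 := fun n =>
    (G.dependsUpTo_avgCost le_rfl).comp fun y => Metric.infDist y D ^ 2
  have hsummable : Summable fun j : ℕ => C * (1 / ((j + 1 : ℕ) : ℝ) ^ 2) :=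
    ((summable_nat_add_iff 1).2 (Real.summable_one_div_nat_pow.2 one_lt_two)).mul_left C
  -- The bound `C / k` is not summable, but along `k = (j + 1) ^ 2` it is; hence the fourth powers
  -- as times.
  have hlim := ae_tendsto_zero_of_summable_integral (μ := G.law (G.blockStrategy f) σ₂ s₀)
    (f := fun (j : ℕ) ω => Metric.infDist (G.avgCost ω (((j + 1) ^ 2) ^ 2)) D ^ 2)
    (fun j => (hdep _).integrable _) (fun j => (hdep _).measurable) (fun _ _ => sq_nonneg _)
    hsummable fun j => (hC σ₂ s₀ ((j + 1) ^ 2) (by positivity)).trans_eq (by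
      push_cast
      ring)
  filter_upwards [hlim] with ω hω
  refine G.tendsto_infDist_of_pow_four hB0 hB ((tendsto_add_atTop_iff_nat 1).1 ?_)
  have h1 := (Real.continuous_sqrt.tendsto 0).comp hω
  rw [Real.sqrt_zero] at h1
  refine h1.congr fun j => ?_
  simp only [Function.comp_apply, Real.sqrt_sq Metric.infDist_nonneg, ← pow_mul]

end StackelbergGame

/-! ### The proposition -/

theorem mainTheorem2 {S A₁ A₂ : Type*} [Fintype S] [Fintype A₁] [Fintype A₂]
    [Nonempty S] [Nonempty A₁] [Nonempty A₂] {K : ℕ}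
    (G : StackelbergGame S A₁ A₂ K) (hG : G.Irreducible)
    (D : Set (EuclideanSpace ℝ (Fin K))) (hne : D.Nonempty) (hclosed : IsClosed D)
    (hconv : Convex ℝ D) :
    (G.Approachable D →
      (∀ (v : EuclideanSpace ℝ (Fin K)) (b : ℝ), v ≠ 0 → D ⊆ {y | inner ℝ y v ≤ b} →
        G.Approachable {y | inner ℝ y v ≤ b}) ∧
      (∀ x ∉ D, ∃ ψ ∈ G.minMaxOccupations (steerDir D x),
        inner ℝ (G.ergodicCost ψ) (steerDir D x) = G.minMaxValue (steerDir D x) ∧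
        inner ℝ (G.ergodicCost ψ - projPoint D x) (steerDir D x) ≤ 0)) ∧
    (G.Approachable D ↔
      ∀ x ∉ D, ∃ ψ ∈ G.ergodicOccupations,
        inner ℝ (G.ergodicCost ψ) (steerDir D x) = G.minMaxValue (steerDir D x) ∧
        inner ℝ (G.ergodicCost ψ - projPoint D x) (steerDir D x) ≤ 0) := by
  have key : G.Approachable D → ∀ x ∉ D, ∃ ψ ∈ G.minMaxOccupations (steerDir D x),
      inner ℝ (G.ergodicCost ψ) (steerDir D x) = G.minMaxValue (steerDir D x) ∧
      inner ℝ (G.ergodicCost ψ - projPoint D x) (steerDir D x) ≤ 0 := by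
    intro hD x _
    obtain ⟨H, -, hopt⟩ := G.exists_isOptimal hG
    obtain ⟨v, h, f₁, f₂, hh, ho⟩ := hopt _ (norm_steerDir_le (D := D) x)
    obtain ⟨ψ, hψ, hψv⟩ := ho.exists_mem_minMaxOccupations
    refine ⟨ψ, hψ, hψv.trans ho.minMaxValue_eq.symm, ?_⟩
    rw [inner_sub_left, hψv, sub_nonpos]
    exact ho.le_of_approachable hh (norm_steerDir_le x) hne hD fun z hz =>
      inner_steerDir_le hclosed hne hconv x hz
  refine ⟨fun hD => ⟨fun v b _ hsub => StackelbergGame.approachable_mono hD hne hsub, key hD⟩,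
    fun hD x hx => ?_, fun hψ => ?_⟩
  · obtain ⟨ψ, hψ, h⟩ := key hD x hx
    exact ⟨ψ, G.minMaxOccupations_subset _ hψ, h⟩
  -- The given measure serves only to bound the min-max value by `⟨P_D(x), λ(x)⟩`; steering uses the
  -- selectors of the optimality equation.
  · refine G.approachable_of_minMaxValue_le hG hne hclosed fun x hx => ?_
    obtain ⟨ψ, -, h1, h2⟩ := hψ x hx
    rw [← h1, ← sub_nonpos, ← inner_sub_left]
    exact h2
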